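/- Conventions. All graphs may be infinite. A *separation* of a graph $G$ with vertex set $V$ is a set $\{A,B\}$ with $A\cup B=V$ and no edge of $G$ between $A\setminus B$ and $B\setminus A$; its *order* is $|A\cap B|$. Its *orientations* are $\vec s=(A,B)$ and $\overleftarrow{s}=(B,A)$, which are *inverse* to each other. Write $(A,B)\le(C,D)$ if $A\subseteq C$ and $B\supseteq D$, and put $(A,B)\wedge(C,D)=(A\cap C,B\cup D)$, $(A,B)\vee(C,D)=(A\cup C,B\cap D)$. For $k\in\mathbb N$, $S_k(G)$ is the set of separations of order $<k$ and $\vec S_k(G)$ the set of their orientations. A *star* is a set $\sigma\not\ni(V,V)$ of oriented separations of finite order with $\vec r\le\overleftarrow{s}$ for all distinct $\vec r,\vec s\in\sigma$; its *interior* is $\operatorname{int}(\sigma)=\bigcap_{(A,B)\in\sigma}B$ (so $\operatorname{int}(\emptyset)=V$). A set $\mathcal F$ of stars is *$m$-bounded* if $|\operatorname{int}(\varrho)|\le m$ for all $\varrho\in\mathcal F$. An *orientation* of $S_k(G)$ is a set $O\subseteq\vec S_k(G)$ containing exactly one orientation of each element of $S_k(G)$. It is *consistent* if there are no $\vec r<\vec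 s$ that orient distinct separations such that $\overleftarrow{r},\vec s\in O$. It *avoids* a set $\mathcal F$ of subsets of $\vec S_k(G)$ if no element of $\mathcal F$ is a subset of $O$. An *$\mathcal F$-tangle* of $S_k(G)$ is a consistent orientation of $S_k(G)$ that avoids $\mathcal F$. A *$k$-profile* in $G$ is a consistent orientation $P$ of $S_k(G)$ such that $(B\cap D,A\cup C)\notin P$ for all $(A,B),(C,D)\in P$. An oriented separation $(A,B)$ is *closely related* to an orientation $O$ of $S_k(G)$ if $(A,B)\in O$ and $(A\cap C,B\cup D)\in\vec S_k(G)$ for every $(C,D)\in O$. Let $\vec s\in\vec S_k(G)$ and let $\vec r$ be an oriented separation. Then $\vec s$ *emulates* $\vec r$ in $\vec S_k(G)$ if $\vec s\ge\vec r$ and $\vec s\vee\vec x\in\vec S_k(G)$ for every $\vec x\in\vec S_k(G)$ with $\vec x\ge\vec r$. A set $\mathcal F$ of stars contained in $\vec S_k(G)$ is *nice* if * it is *strongly closed under shifting*: whenever $\vec s\in\vec S_k(G)$ emulates some $\vec r\in\vec S_{2k-1}(G)$ in $\vec S_k(G)$, then for every $\sigma\in\mathcal F$ with $\overleftarrow{r}\notin\sigma$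 such that $\vec x\ge\vec r$ or $\overleftarrow{x}\ge\vec r$ for each $\vec x\in\sigma$, and for every $\vec t\in\sigma$ with $\vec t\ge\vec r$, we have $\{\vec s\vee\vec t\}\cup\{\overleftarrow{s}\wedge\vec x:\vec x\in\sigma\setminus\{\vec t\}\}\in\mathcal F$; * $\{(V,A)\}\in\mathcal F$ for every $A\subseteq V$ with $|A|<k$; and * $\mathcal F$ contains every set $\varrho=\{(A,B),(B\cap C,A\cup D),(B\cap D,A\cup C)\}\subseteq\vec S_k(G)$ with $(A,B),(C,D)\in\vec S_k(G)$ and $|\operatorname{int}(\varrho)|<k$. (As $\{(V,V)\}$ is not a star, nice sets exist only if $|V|\ge k$.) A separation $(A,B)$ of finite order is *left-$\ell$-robust* if there are a set $U\subseteq A$ with $|U|=\ell$ and pairwise disjoint paths $P_x$ in $G[A]$, one for each $x\in A\cap B$, such that $P_x$ ends in $x$ and there are $\ell$ distinct $U$–$P_x$ paths in $G[(A\setminus B)\cup\{x\}]$ any two of which meet at most in their endvertices in $P_x$. (A *$U$–$P$ path* is a path that meets $U$ precisely in its first vertex and $P$ precisely in its last vertex.) A *finite $S_k(G)$-tree* $(T,\alpha)$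 consists of a finite tree $T$ and a map $\alpha$ from the oriented edges $(t,t')$ of $T$ to $\vec S_k(G)$ such that $\alpha(t',t)$ is the inverse of $\alpha(t,t')$. It is *over* a set $\mathcal F$ of subsets of $\vec S_k(G)$ if $\{\alpha(t',t):t'\in N_T(t)\}\in\mathcal F$ for every node $t$ of $T$. Its *leaf separations* are the $\alpha(x,t)$ with $x$ a leaf of $T$ and $t$ the unique neighbour of $x$. **Lemma 4.4.** Let $G$ be a graph, let $k,m\in\mathbb N$, and let $\mathcal F$ be an $m$-bounded, nice set of stars in $\vec S_k(G)$. Set $\ell:=\max\{3k-2,\;k(k-1)m+m\}$, and let $\sigma\subseteq\vec S_k(G)$ be a finite star with finite interior. Suppose that every $\vec s\in\sigma$ is left-$\ell$-robust or its inverse $\overleftarrow{s}$ is closely related to some $k$-profile in $G$ that avoids $\mathcal F$. Set $\mathcal F':=\mathcal F\cup\{\{\overleftarrow{s}\}:\vec s\in\sigma\}$. Then there is an $\mathcal F'$-tangle of $S_k(G)$, or there is a finite $S_k(G)$-tree over $\mathcal F'$ in which every $\vec s\in\sigma$ appears as a leaf separation. -/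

import Mathlib

namespace TangleTree

universe u

/-- An oriented separation `(A, B)` of the graph `G`, with `A = left` and `B = right`. -/
@[ext]
structure OSep {V : Type u} (G : SimpleGraph V) where
  left : Set V
  right : Set V
  cover : left ∪ right = Set.univ
  no_edge : ∀ v ∈ left \ right, ∀ w ∈ right \ left, ¬ G.Adj v w

namespace OSep

variable {V : Type u} {G : SimpleGraph V}

/-- The inverse `(B, A)` of `(A, B)`. -/
def inv (s : OSep G) : OSep G where
  left := s.right
  right := s.left
  cover := by rw [Set.union_comm]; exact s.cover
  no_edge := fun v hv w hw h => s.no_edge w hw v hv h.symm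

/-- `(A, B) ≤ (C, D)` if and only if `A ⊆ C` and `D ⊆ B`. -/
instance : PartialOrder (OSep G) where
  le s t := s.left ⊆ t.left ∧ t.right ⊆ s.right
  le_refl _ := ⟨subset_rfl, subset_rfl⟩
  le_trans _ _ _ h h' := ⟨h.1.trans h'.1, h'.2.trans h.2⟩
  le_antisymm _ _ h h' := OSep.ext (h.1.antisymm h'.1) (h'.2.antisymm h.2)

/-- The infimum `(A ∩ C, B ∪ D)` of `(A, B)` and `(C, D)`. -/
def inf (s t : OSep G) : OSep G where
  left := s.left ∩ t.left
  right := s.right ∪ t.right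
  cover := by
    ext v
    have h1 : v ∈ s.left ∪ s.right := by rw [s.cover]; trivial
    have h2 : v ∈ t.left ∪ t.right := by rw [t.cover]; trivial
    simp only [Set.mem_union, Set.mem_inter_iff, Set.mem_univ, iff_true] at *
    tauto
  no_edge := by
    rintro v ⟨⟨hv1, hv2⟩, hv3⟩ w ⟨hw1, hw2⟩ hvw
    have h1 : w ∈ s.left ∪ s.right := by rw [s.cover]; trivial
    have h2 : w ∈ t.left ∪ t.right := by rw [t.cover]; trivial
    have h3 := s.no_edge v
    have h4 := t.no_edge v
    simp only [Set.mem_union, Set.mem_inter_iff, Set.mem_sdiff, not_or, not_and] at *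
    by_cases hs : w ∈ s.left
    · have ht : w ∉ t.left := hw2 hs
      exact h4 ⟨hv2, hv3.2⟩ w ⟨by tauto, ht⟩ hvw
    · exact h3 ⟨hv1, hv3.1⟩ w ⟨by tauto, hs⟩ hvw

/-- The supremum `(A ∪ C, B ∩ D)` of `(A, B)` and `(C, D)`. -/
def sup (s t : OSep G) : OSep G where
  left := s.left ∪ t.left
  right := s.right ∩ t.right
  cover := (inf s.inv t.inv).inv.cover
  no_edge := (inf s.inv t.inv).inv.no_edge

instance : Lattice (OSep G) where
  sup := sup
  inf := inf
  le_sup_left _ _ := ⟨Set.subset_union_left, Set.inter_subset_left⟩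
  le_sup_right _ _ := ⟨Set.subset_union_right, Set.inter_subset_right⟩
  sup_le _ _ _ h h' := ⟨Set.union_subset h.1 h'.1, Set.subset_inter h.2 h'.2⟩
  inf_le_left _ _ := ⟨Set.inter_subset_left, Set.subset_union_left⟩
  inf_le_right _ _ := ⟨Set.inter_subset_right, Set.subset_union_right⟩
  le_inf _ _ _ h h' := ⟨Set.subset_inter h.1 h'.1, Set.union_subset h.2 h'.2⟩

/-- The order `|A ∩ B|` of `(A, B)`. -/
noncomputable def order (s : OSep G) : ℕ∞ := (s.left ∩ s.right).encard

/-- The separation `(V, A)`. -/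
def cosmall (G : SimpleGraph V) (A : Set V) : OSep G where
  left := Set.univ
  right := A
  cover := Set.univ_union A
  no_edge := fun _ _ _ hw _ => hw.2 trivial

end OSep

section

variable {V : Type u} {G : SimpleGraph V}

/-- The set of all orientations of separations of `G` of order less than `k`. A set of unoriented
separations is always represented by the set of all orientations of its elements. -/
def sepSys (G : SimpleGraph V) (k : ℕ) : Set (OSep G) := {s | s.order < (k : ℕ∞)}

/-- A star: a set of finite-order separations other than `(V, V)` such that distinct elements
`r`, `s` satisfy `r ≤ s.inv`. -/
def IsStar (σ : Set (OSep G)) : Prop :=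
  (∀ s ∈ σ, s.order < ⊤) ∧ OSep.cosmall G Set.univ ∉ σ ∧ σ.Pairwise fun r s => r ≤ s.inv

/-- The interior of a star: the intersection of all its big sides (all of `V` if the star is
empty). -/
def starInterior (σ : Set (OSep G)) : Set V := {v | ∀ s ∈ σ, v ∈ s.right}

/-- `O` contains exactly one orientation of every separation in `S`, and nothing else. -/
def IsOrientation (S O : Set (OSep G)) : Prop :=
  O ⊆ S ∧ ∀ s ∈ S, ∃! t, (t = s ∨ t = s.inv) ∧ t ∈ O

/-- `O` does not contain both `r.inv` and `s` whenever `r < s` are orientations of distinct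
separations. -/
def IsConsistent (O : Set (OSep G)) : Prop :=
  ∀ r s : OSep G, r < s → r ≠ s.inv → ¬ (r.inv ∈ O ∧ s ∈ O)

/-- `O` has no element of `F` as a subset. -/
def Avoids (O : Set (OSep G)) (F : Set (Set (OSep G))) : Prop := ∀ ϱ ∈ F, ¬ ϱ ⊆ O

/-- `O` is an `F`-tangle of `S`. -/
def IsTangle (S : Set (OSep G)) (F : Set (Set (OSep G))) (O : Set (OSep G)) : Prop :=
  IsOrientation S O ∧ IsConsistent O ∧ Avoids O F

/-- `P` is a `k`-profile in `G`. -/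
def IsProfile (k : ℕ) (P : Set (OSep G)) : Prop :=
  IsOrientation (sepSys G k) P ∧ IsConsistent P ∧ ∀ r ∈ P, ∀ s ∈ P, (r ⊔ s).inv ∉ P

/-- The family of all sets `{(A, B), (B ∩ C, A ∪ D), (B ∩ D, A ∪ C)}` of separations of order less
than `k`, where `(A, B)` and `(C, D)` have order less than `k`. -/
def profileTriples (G : SimpleGraph V) (k : ℕ) : Set (Set (OSep G)) :=
  {σ | σ ⊆ sepSys G k ∧ ∃ r ∈ sepSys G k, ∃ s ∈ sepSys G k,
    σ = {r, r.inv ⊓ s, r.inv ⊓ s.inv}}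

/-- The elements of `profileTriples G k` whose interior has fewer than `k` vertices. -/
def smallProfileTriples (G : SimpleGraph V) (k : ℕ) : Set (Set (OSep G)) :=
  {σ | σ ∈ profileTriples G k ∧ (starInterior σ).encard < (k : ℕ∞)}

/-- `s` emulates `r` in `S`. -/
def Emulates (S : Set (OSep G)) (s r : OSep G) : Prop :=
  s ∈ S ∧ r ≤ s ∧ ∀ x ∈ S, r ≤ x → s ⊔ x ∈ S

/-- The orientations of those separations in `S` that have an orientation `≥ r`. -/
def above (S : Set (OSep G)) (r : OSep G) : Set (OSep G) := {x ∈ S | r ≤ x ∨ r ≤ x.inv}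

/-- `s` emulates `r` in `S` for `F`. -/
def EmulatesFor (S : Set (OSep G)) (F : Set (Set (OSep G))) (s r : OSep G) : Prop :=
  Emulates S s r ∧ ∀ σ ∈ F, σ ⊆ above S r \ {r.inv} → ∀ t ∈ σ, r ≤ t →
    {s ⊔ t} ∪ (fun t' => s.inv ⊓ t') '' (σ \ {t}) ∈ F

/-- `F` is strongly closed under shifting in the set of all separations of order `< k`. -/
def StronglyClosed (k : ℕ) (F : Set (Set (OSep G))) : Prop :=
  ∀ s ∈ sepSys G k, ∀ r ∈ sepSys G (2 * k - 1),
    Emulates (sepSys G k) s r → EmulatesFor (sepSys G k) F s r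

/-- `F` is a set of stars of separations of order `< k`. -/
def IsStarSet (k : ℕ) (F : Set (Set (OSep G))) : Prop :=
  ∀ ϱ ∈ F, IsStar ϱ ∧ ϱ ⊆ sepSys G k

/-- `F` is a nice set of stars of separations of order `< k`. -/
def IsNice (k : ℕ) (F : Set (Set (OSep G))) : Prop :=
  IsStarSet k F ∧ StronglyClosed k F ∧
    (∀ A : Set V, A.encard < (k : ℕ∞) → {OSep.cosmall G A} ∈ F) ∧
    smallProfileTriples G k ⊆ F

/-- `F` is `m`-bounded. -/
def IsBounded (m : ℕ) (F : Set (Set (OSep G))) : Prop :=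
  ∀ ϱ ∈ F, (starInterior ϱ).encard ≤ (m : ℕ∞)

/-- `s` is closely related to the orientation `O` of the set of all separations of order `< k`. -/
def IsCloselyRelated (k : ℕ) (s : OSep G) (O : Set (OSep G)) : Prop :=
  s ∈ O ∧ ∀ r ∈ O, s ⊓ r ∈ sepSys G k

/-- The finite-order separation `s = (A, B)` is left-`ℓ`-robust. The paths `P x` are only relevant
for `x ∈ A ∩ B`. A path from `U` to `P x` meets `U` precisely in its first vertex and `P x`
precisely in its last vertex. As `|U| = ℓ` and any two distinct such paths may share only a common
last vertex on `P x`, a system of `ℓ` distinct paths has precisely one path `Q w` starting in each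
`w ∈ U`. -/
def IsLeftRobust (ℓ : ℕ) (s : OSep G) : Prop :=
  s.order < ⊤ ∧ ∃ U : Set V, U ⊆ s.left ∧ U.encard = (ℓ : ℕ∞) ∧
    ∃ (a : V → V) (P : ∀ x, G.Walk (a x) x),
      (∀ x ∈ s.left ∩ s.right, (P x).IsPath ∧ ∀ v ∈ (P x).support, v ∈ s.left) ∧
      (∀ x ∈ s.left ∩ s.right, ∀ y ∈ s.left ∩ s.right, x ≠ y →
        ∀ v ∈ (P x).support, v ∉ (P y).support) ∧
      ∀ x ∈ s.left ∩ s.right, ∃ (b : V → V) (Q : ∀ w, G.Walk w (b w)),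
        (∀ w ∈ U, (Q w).IsPath ∧
          (∀ v ∈ (Q w).support, v ∈ (s.left \ s.right) ∪ {x}) ∧
          (∀ v ∈ (Q w).support, v ∈ U ↔ v = w) ∧
          (∀ v ∈ (Q w).support, v ∈ (P x).support ↔ v = b w)) ∧
        ∀ w ∈ U, ∀ w' ∈ U, w ≠ w' →
          ∀ v ∈ (Q w).support, v ∈ (Q w').support → v = b w ∧ v = b w'

/-- `(T, α)` is an `S`-tree; the darts of `T` are its oriented edges. -/
def IsSTree {W : Type*} (S : Set (OSep G)) (T : SimpleGraph W) (α : T.Dart → OSep G) : Prop :=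
  T.IsTree ∧ (∀ d, α d ∈ S) ∧ ∀ d, α d.symm = (α d).inv

/-- The set of all `α (t', t)` where `t'` is a neighbour of `t`. -/
def nodeStar {W : Type*} (T : SimpleGraph W) (α : T.Dart → OSep G) (t : W) : Set (OSep G) :=
  {s | ∃ d : T.Dart, d.snd = t ∧ α d = s}

/-- `(T, α)` is over `F`. -/
def IsOver {W : Type*} (F : Set (Set (OSep G))) (T : SimpleGraph W) (α : T.Dart → OSep G) : Prop :=
  ∀ t, nodeStar T α t ∈ F

/-- `s = α (x, t)` for some leaf `x` of `T`, where `t` is the unique neighbour of `x`. -/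
def IsLeafSeparation {W : Type*} (T : SimpleGraph W) (α : T.Dart → OSep G) (s : OSep G) : Prop :=
  ∃ d : T.Dart, T.neighborSet d.fst = {d.snd} ∧ α d = s

/-- The family `F` together with all singletons `{s.inv}` for `s ∈ σ`. -/
def addInverses (F : Set (Set (OSep G))) (σ : Set (OSep G)) : Set (Set (OSep G)) :=
  F ∪ {ϱ | ∃ s ∈ σ, ϱ = {s.inv}}

end

end TangleTree

open TangleTree

namespace TangleTree

universe u

section

namespace OSep

variable {V : Type u} {G : SimpleGraph V}

@[simp] theorem left_inv (s : OSep G) : s.inv.left = s.right := rfl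
@[simp] theorem right_inv (s : OSep G) : s.inv.right = s.left := rfl
@[simp] theorem left_sup (s t : OSep G) : (s ⊔ t).left = s.left ∪ t.left := rfl
@[simp] theorem right_sup (s t : OSep G) : (s ⊔ t).right = s.right ∩ t.right := rfl
@[simp] theorem left_inf (s t : OSep G) : (s ⊓ t).left = s.left ∩ t.left := rfl
@[simp] theorem right_inf (s t : OSep G) : (s ⊓ t).right = s.right ∪ t.right := rfl
@[simp] theorem left_cosmall (A : Set V) : (cosmall G A).left = Set.univ := rfl
@[simp] theorem right_cosmall (A : Set V) : (cosmall G A).right = A := rfl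
@[simp] theorem inv_inv (s : OSep G) : s.inv.inv = s := rfl

theorem mem_or_mem (s : OSep G) (v : V) : v ∈ s.left ∨ v ∈ s.right := by
  have h : v ∈ s.left ∪ s.right := by rw [s.cover]; trivial
  exact h

theorem inv_sup (s t : OSep G) : (s ⊔ t).inv = s.inv ⊓ t.inv := rfl
theorem inv_inf (s t : OSep G) : (s ⊓ t).inv = s.inv ⊔ t.inv := rfl

theorem inv_injective : Function.Injective (inv : OSep G → OSep G) :=
  fun s t h => by rw [← inv_inv s, h, inv_inv]

theorem inv_le_inv {s t : OSep G} : s.inv ≤ t.inv ↔ t ≤ s := and_comm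

theorem le_inv_comm {s t : OSep G} : s ≤ t.inv ↔ t ≤ s.inv := and_comm

theorem inv_le_comm {s t : OSep G} : s.inv ≤ t ↔ t.inv ≤ s := and_comm

instance : DistribLattice (OSep G) where
  le_sup_inf s t r := by
    refine ⟨?_, ?_⟩ <;> intro v <;> simp <;> tauto

@[simp] theorem order_inv (s : OSep G) : s.inv.order = s.order := by
  simp [order, Set.inter_comm]

theorem eq_cosmall_of_inv_le {s : OSep G} (h : s.inv ≤ s) : s = cosmall G s.right := by
  ext v
  · have := s.mem_or_mem v
    have h1 : v ∈ s.right → v ∈ s.left := fun hv => h.1 hv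
    simp; tauto
  · simp

theorem order_cosmall (A : Set V) : (cosmall G A).order = A.encard := by
  simp [order]

theorem order_sup_add_order_inf_le (s t : OSep G) :
    (s ⊔ t).order + (s ⊓ t).order ≤ s.order + t.order := by
  unfold order
  rw [← Set.encard_union_add_encard_inter, ← Set.encard_union_add_encard_inter (s.left ∩ s.right)]
  refine add_le_add (Set.encard_le_encard ?_) (Set.encard_le_encard ?_) <;> intro v <;>
    simp <;> tauto

theorem order_sup_le {s t : OSep G} (hs : s.order < ⊤) (h : s.order ≤ (s ⊓ t).order) :
    (s ⊔ t).order ≤ t.order := by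
  have h1 : s.order + (s ⊔ t).order ≤ s.order + t.order := by
    rw [add_comm s.order]
    exact (add_le_add_right h _).trans (order_sup_add_order_inf_le s t)
  exact (ENat.add_le_add_iff_left hs.ne).1 h1

end OSep

variable {V : Type u} {G : SimpleGraph V} {k : ℕ}

theorem mem_sepSys {s : OSep G} : s ∈ sepSys G k ↔ s.order < (k : ℕ∞) := Iff.rfl

@[simp] theorem inv_mem_sepSys {s : OSep G} : s.inv ∈ sepSys G k ↔ s ∈ sepSys G k := by
  simp [mem_sepSys]

theorem order_lt_top {s : OSep G} (hs : s ∈ sepSys G k) : s.order < ⊤ :=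
  lt_of_lt_of_le hs le_top

theorem sup_mem_or_inf_mem {s t : OSep G} (hs : s ∈ sepSys G k) (ht : t ∈ sepSys G k) :
    s ⊔ t ∈ sepSys G k ∨ s ⊓ t ∈ sepSys G k := by
  by_contra! h
  simp only [mem_sepSys, not_lt] at h hs ht
  have h1 := OSep.order_sup_add_order_inf_le s t
  have h2 : s.order + t.order < k + k := ENat.add_lt_add hs ht
  exact absurd (h1.trans_lt h2) (not_lt.2 (add_le_add h.1 h.2))

/-- `S` is closed under inversion. -/
def InvClosed (S : Set (OSep G)) : Prop := ∀ s ∈ S, s.inv ∈ S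

/-- A down-closed set of separations containing exactly one of `s` and `s.inv` for `s ∈ S`. -/
structure IsDownOrientation (S O : Set (OSep G)) : Prop where
  subset : O ⊆ S
  total : ∀ s ∈ S, s ∈ O ∨ s.inv ∈ O
  not_both : ∀ s ∈ O, s.inv ∉ O
  lower : ∀ x ∈ S, ∀ y ∈ O, x ≤ y → x ∈ O

theorem IsDownOrientation.isOrientation {S O : Set (OSep G)} (h : IsDownOrientation S O) :
    IsOrientation S O := by
  refine ⟨h.subset, fun s hs => ?_⟩
  rcases h.total s hs with h1 | h1
  · refine ⟨s, ⟨Or.inl rfl, h1⟩, ?_⟩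
    rintro t ⟨rfl | rfl, ht⟩
    · rfl
    · exact absurd ht (h.not_both _ h1)
  · refine ⟨s.inv, ⟨Or.inr rfl, h1⟩, ?_⟩
    rintro t ⟨rfl | rfl, ht⟩
    · exact absurd h1 (h.not_both _ ht)
    · rfl

theorem IsDownOrientation.isConsistent {S O : Set (OSep G)} (hS : InvClosed S)
    (h : IsDownOrientation S O) : IsConsistent O := by
  rintro r s hrs - ⟨hr, hs⟩
  exact h.not_both r (h.lower r (hS _ (h.subset hr)) s hs hrs.le) hr

theorem IsNice.ne_inv {F : Set (Set (OSep G))} (hF : IsNice k F) {s : OSep G}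
    (hs : s ∈ sepSys G k) : s ≠ s.inv := by
  intro h
  have h1 : s.right = s.left := congrArg OSep.left h.symm
  have h2 : s.left = Set.univ := by rw [← s.cover, h1, Set.union_self]
  have h3 : (Set.univ : Set V).encard < k := by
    have := mem_sepSys.1 hs
    rwa [OSep.order, h1, h2, Set.inter_self] at this
  exact (hF.1 _ (hF.2.2.1 _ h3)).1.2.1 rfl

theorem isDownOrientation_of_isConsistent {F : Set (Set (OSep G))} (hF : IsNice k F)
    {O : Set (OSep G)} (hO : IsOrientation (sepSys G k) O) (hc : IsConsistent O)
    (hA : Avoids O F) : IsDownOrientation (sepSys G k) O := by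
  have total : ∀ s ∈ sepSys G k, s ∈ O ∨ s.inv ∈ O := by
    intro s hs
    obtain ⟨t, ⟨rfl | rfl, ht⟩, -⟩ := hO.2 s hs
    exacts [Or.inl ht, Or.inr ht]
  have nb : ∀ s ∈ O, s.inv ∉ O := by
    intro s hs hs'
    obtain ⟨t, -, ht⟩ := hO.2 s (hO.1 hs)
    exact hF.ne_inv (hO.1 hs) ((ht s ⟨Or.inl rfl, hs⟩).trans (ht s.inv ⟨Or.inr rfl, hs'⟩).symm)
  refine ⟨hO.1, total, nb, fun x hx y hy hxy => ?_⟩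
  rcases total x hx with h | h
  · exact h
  rcases hxy.eq_or_lt with rfl | hlt
  · exact hy
  by_cases hxi : x = y.inv
  · exfalso
    have h1 := OSep.eq_cosmall_of_inv_le (hxi ▸ hxy)
    have h2 : y.right.encard < k := by
      rw [← OSep.order_cosmall (G := G), ← h1]; exact hO.1 hy
    refine hA _ (hF.2.2.1 _ h2) ?_
    rw [← h1]
    simpa using hy
  · exact absurd ⟨h, hy⟩ (hc x y hlt hxi)

/-- The separations having, for each `s ∈ τ`, an orientation `≥ s`. -/
def nestedAbove (τ : Set (OSep G)) : Set (OSep G) := {x | ∀ s ∈ τ, s ≤ x ∨ s ≤ x.inv}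

theorem inv_mem_nestedAbove {τ : Set (OSep G)} {x : OSep G} (hx : x ∈ nestedAbove τ) :
    x.inv ∈ nestedAbove τ := fun s hs => (hx s hs).symm

theorem sup_mem_nestedAbove {τ : Set (OSep G)} {x y : OSep G} (hx : x ∈ nestedAbove τ)
    (hy : y ∈ nestedAbove τ) : x ⊔ y ∈ nestedAbove τ := by
  intro s hs
  rcases hx s hs with h | h
  · exact Or.inl (h.trans le_sup_left)
  rcases hy s hs with h' | h'
  · exact Or.inl (h'.trans le_sup_right)
  · exact Or.inr (by rw [OSep.inv_sup]; exact le_inf h h')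

theorem inf_mem_nestedAbove {τ : Set (OSep G)} {x y : OSep G} (hx : x ∈ nestedAbove τ)
    (hy : y ∈ nestedAbove τ) : x ⊓ y ∈ nestedAbove τ :=
  inv_mem_nestedAbove (sup_mem_nestedAbove (inv_mem_nestedAbove hx) (inv_mem_nestedAbove hy))

/-- The separations of order `< k` having, for each `s ∈ τ`, an orientation `≥ s`. -/
def sepAbove (k : ℕ) (τ : Set (OSep G)) : Set (OSep G) := sepSys G k ∩ nestedAbove τ

theorem invClosed_sepAbove (τ : Set (OSep G)) : InvClosed (sepAbove k τ) :=
  fun _ hs => ⟨inv_mem_sepSys.2 hs.1, inv_mem_nestedAbove hs.2⟩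

theorem IsStar.subset_nestedAbove {σ : Set (OSep G)} (hσ : IsStar σ) {τ : Set (OSep G)}
    (hτ : τ ⊆ σ) : σ ⊆ nestedAbove τ := by
  intro q hq s hs
  by_cases h : s = q
  · exact Or.inl h.le
  · exact Or.inr (hσ.2.2 (hτ hs) hq h)

/-- A nested separation is determined by its trace on the interior and the elements of the star
below it. -/
theorem finite_nestedAbove {σ : Set (OSep G)} (hfin : σ.Finite) (hint : (starInterior σ).Finite) :
    (nestedAbove σ).Finite := by
  let f : OSep G → Set V × Set V × Set (OSep G) := fun x =>
    (x.left ∩ starInterior σ, x.right ∩ starInterior σ, {s ∈ σ | s ≤ x})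
  have hf : (f '' nestedAbove σ).Finite := by
    refine Set.Finite.subset ((hint.finite_subsets).prod
      ((hint.finite_subsets).prod hfin.finite_subsets)) ?_
    rintro _ ⟨x, -, rfl⟩
    exact ⟨Set.inter_subset_right, Set.inter_subset_right, Set.sep_subset _ _⟩
  refine hf.of_finite_image ?_
  intro x hx y hy hxy
  simp only [f, Prod.mk.injEq] at hxy
  obtain ⟨h1, h2, h3⟩ := hxy
  have key : ∀ z ∈ nestedAbove σ, ∀ s ∈ σ, ∀ v ∉ s.right,
      (v ∈ z.left ↔ s ≤ z) ∧ (v ∈ z.right ↔ ¬ s ≤ z) := by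
    intro z hz s hs v hv
    have hvs : v ∈ s.left := (s.mem_or_mem v).resolve_right hv
    by_cases h : s ≤ z
    · have : v ∉ z.right := fun h' => hv (h.2 h')
      simp [h, h.1 hvs, this]
    · have h' := (hz s hs).resolve_left h
      have h4 : v ∈ z.right := h'.1 hvs
      have : v ∉ z.left := fun h5 => hv (h'.2 h5)
      simp [h, h4, this]
  have hs : ∀ s ∈ σ, (s ≤ x ↔ s ≤ y) := by
    intro s hs
    have := Set.ext_iff.1 h3 s
    simpa [hs] using this
  ext v
  · by_cases hv : v ∈ starInterior σ
    · have := Set.ext_iff.1 h1 v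
      simpa [hv] using this
    · simp only [starInterior, Set.mem_ofPred_eq, not_forall] at hv
      obtain ⟨s, hsσ, hv⟩ := hv
      rw [(key x hx s hsσ v hv).1, (key y hy s hsσ v hv).1, hs s hsσ]
  · by_cases hv : v ∈ starInterior σ
    · have := Set.ext_iff.1 h2 v
      simpa [hv] using this
    · simp only [starInterior, Set.mem_ofPred_eq, not_forall] at hv
      obtain ⟨s, hsσ, hv⟩ := hv
      rw [(key x hx s hsσ v hv).2, (key y hy s hsσ v hv).2, hs s hsσ]

/-- Every separation of order `< k` can be uncrossed from `s` within the separations of order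
`< k`. -/
def Uncrosses (k : ℕ) (s : OSep G) : Prop :=
  ∀ y ∈ sepSys G k, s ⊔ y ∈ sepSys G k ∨ s.inv ⊓ y ∈ sepSys G k

/-- The order of `e ⊔ z` does not drop when `z` is uncrossed from the elements of `τ`. -/
theorem exists_uncrossed {τ : Set (OSep G)} (hτ : τ.Finite)
    (hpair : τ.Pairwise fun r s => r ≤ s.inv) (hunc : ∀ s ∈ τ, Uncrosses k s)
    {e r z : OSep G} (hr : r ∈ nestedAbove τ) (he : ∀ s ∈ τ, s ≤ e) (hz : z ∈ sepSys G k)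
    (hrz : r ≤ z) :
    ∃ z' ∈ sepAbove k τ, r ≤ z' ∧ (e ⊔ z).order ≤ (e ⊔ z').order := by
  induction τ, hτ using Set.Finite.induction_on with
  | empty => exact ⟨z, ⟨hz, by simp [nestedAbove]⟩, hrz, le_rfl⟩
  | @insert s τ hs _ ih =>
    obtain ⟨z', hz', hrz', hord⟩ := ih (hpair.mono (Set.subset_insert _ _))
      (fun t ht => hunc t (Set.mem_insert_of_mem _ ht))
      (fun t ht => hr t (Set.mem_insert_of_mem _ ht))
      (fun t ht => he t (Set.mem_insert_of_mem _ ht))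
    have hsτ : s ∈ nestedAbove τ := fun t ht => Or.inr
      (hpair (Set.mem_insert_of_mem _ ht) (Set.mem_insert _ _) (by rintro rfl; exact hs ht))
    by_cases hsr : s ≤ r
    · refine ⟨z', ⟨hz'.1, ?_⟩, hrz', hord⟩
      rintro t (rfl | ht)
      · exact Or.inl (hsr.trans hrz')
      · exact hz'.2 t ht
    have hsr' : s ≤ r.inv := (hr s (Set.mem_insert _ _)).resolve_left hsr
    rcases hunc s (Set.mem_insert _ _) z' hz'.1 with h | h
    · refine ⟨s ⊔ z', ⟨h, ?_⟩, hrz'.trans le_sup_right, hord.trans_eq ?_⟩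
      · rintro t (rfl | ht)
        · exact Or.inl le_sup_left
        · exact sup_mem_nestedAbove hsτ hz'.2 t ht
      · rw [← sup_assoc, sup_eq_left.2 (he s (Set.mem_insert _ _))]
    · refine ⟨s.inv ⊓ z', ⟨h, ?_⟩, le_inf (OSep.le_inv_comm.1 hsr') hrz', hord.trans ?_⟩
      · rintro t (rfl | ht)
        · exact Or.inr (by rw [OSep.inv_inf]; exact le_sup_left)
        · exact inf_mem_nestedAbove (inv_mem_nestedAbove hsτ) hz'.2 t ht
      · refine Set.encard_le_encard ?_
        have hse := (he s (Set.mem_insert _ _)).1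
        rintro v ⟨h1, h2⟩
        have h3 := s.mem_or_mem v
        have h4 : v ∈ s.left → v ∈ e.left := fun hv => hse hv
        simp at h1 h2 ⊢
        tauto

/-- An order-minimal element between `r` and `r'` emulates `r`. -/
theorem emulates_of_minimal {σ : Set (OSep G)} (hσ : σ.Finite)
    (hpair : σ.Pairwise fun r s => r ≤ s.inv) (hunc : ∀ s ∈ σ, Uncrosses k s)
    {e r r' : OSep G} (he : e ∈ sepAbove k σ) (hr : r ∈ nestedAbove σ) (hre : r ≤ e)
    (her : e ≤ r') (hmin : ∀ x ∈ nestedAbove σ, r ≤ x → x ≤ r' → e.order ≤ x.order) :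
    Emulates (sepSys G k) e r := by
  refine ⟨he.1, hre, fun z hz hrz => ?_⟩
  have hsub : {s ∈ σ | s ≤ e} ⊆ σ := Set.sep_subset _ _
  obtain ⟨z', hz', hrz', hord⟩ := exists_uncrossed (hσ.subset hsub) (hpair.mono hsub)
    (fun s hs => hunc s hs.1) (e := e) (fun s hs => hr s hs.1) (fun s hs => hs.2) hz hrz
  have hmem : e ⊓ z' ∈ nestedAbove σ := by
    intro s hs
    by_cases h : s ≤ e
    · rcases hz'.2 s ⟨hs, h⟩ with h' | h'
      · exact Or.inl (le_inf h h')
      · exact Or.inr (by rw [OSep.inv_inf]; exact h'.trans le_sup_right)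
    · exact Or.inr (by
        rw [OSep.inv_inf]; exact ((he.2 s hs).resolve_left h).trans le_sup_left)
  have h1 := hmin _ hmem (le_inf hre hrz') (inf_le_left.trans her)
  exact (hord.trans (OSep.order_sup_le (order_lt_top he.1) h1)).trans_lt hz'.1

/-- Between any two nested elements of `sepAbove k σ` there is one that emulates both. -/
theorem exists_emulates {σ : Set (OSep G)} (hσ : σ.Finite)
    (hpair : σ.Pairwise fun r s => r ≤ s.inv) (hunc : ∀ s ∈ σ, Uncrosses k s)
    {x y : OSep G} (hx : x ∈ sepAbove k σ) (hy : y ∈ sepAbove k σ) (hxy : x ≤ y) :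
    ∃ e ∈ sepAbove k σ, x ≤ e ∧ e ≤ y ∧ Emulates (sepSys G k) e x ∧
      Emulates (sepSys G k) e.inv y.inv := by
  let I : Set (OSep G) := {e | e ∈ nestedAbove σ ∧ x ≤ e ∧ e ≤ y}
  obtain ⟨e, ⟨he, hxe, hey⟩, hmin⟩ := WellFounded.has_min
    (InvImage.wf (OSep.order (G := G)) wellFounded_lt) I ⟨x, hx.2, le_rfl, hxy⟩
  have hmin' : ∀ z ∈ nestedAbove σ, x ≤ z → z ≤ y → e.order ≤ z.order :=
    fun z hz h1 h2 => not_lt.1 (hmin z ⟨hz, h1, h2⟩)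
  have hek : e ∈ sepAbove k σ := ⟨(hmin' x hx.2 le_rfl hxy).trans_lt hx.1, he⟩
  refine ⟨e, hek, hxe, hey, emulates_of_minimal hσ hpair hunc hek hx.2 hxe hey hmin', ?_⟩
  refine emulates_of_minimal hσ hpair hunc (invClosed_sepAbove _ _ hek)
    (inv_mem_nestedAbove hy.2) (OSep.inv_le_inv.2 hey) (OSep.inv_le_inv.2 hxe) ?_
  intro z hz h1 h2
  rw [OSep.order_inv, ← OSep.order_inv z]
  exact hmin' _ (inv_mem_nestedAbove hz) (OSep.le_inv_comm.1 h2) (OSep.inv_le_comm.1 h1)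

end

section

variable {V : Type u} {G : SimpleGraph V}

/-- The star obtained from `ϱ` by shifting its element `t` to `e ⊔ t`. -/
def shiftStar (e t : OSep G) (ϱ : Set (OSep G)) : Set (OSep G) :=
  {e ⊔ t} ∪ (fun x => e.inv ⊓ x) '' (ϱ \ {t})

/-- The separations `y` in `S` for which there is a rooted tree over `F`, all leaves in `D` excepted,
whose root edge is labelled `y` towards the outside. -/
inductive Forced (S : Set (OSep G)) (F : Set (Set (OSep G))) (D : Set (OSep G)) : OSep G → Prop
  | hyp {y : OSep G} : y ∈ D → Forced S F D y
  | node {ϱ : Set (OSep G)} {t : OSep G} : ϱ ∈ F → ϱ ⊆ S → t ∈ ϱ →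
      (∀ x ∈ ϱ, x ≠ t → Forced S F D x) → Forced S F D t.inv

/-- There is a tree over `F`, all leaves in `D` excepted. -/
def Refuted (S : Set (OSep G)) (F : Set (Set (OSep G))) (D : Set (OSep G)) : Prop :=
  ∅ ∈ F ∨ ∃ z, Forced S F D z ∧ Forced S F D z.inv

/-- The family `F` can be shifted within `S` from `r` to `e`. -/
structure Shifts (S : Set (OSep G)) (F : Set (Set (OSep G))) (e r : OSep G) : Prop where
  le : r ≤ e
  sup_mem : ∀ z ∈ S, r ≤ z → e ⊔ z ∈ S
  shift_mem : ∀ ϱ ∈ F, ϱ ⊆ S → ∀ t ∈ ϱ, r ≤ t → r.inv ∉ ϱ → shiftStar e t ϱ ∈ F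

/-- The conditions on `S` and `F` under which tangle-tree duality holds. -/
structure IsDual (S : Set (OSep G)) (F : Set (Set (OSep G))) : Prop where
  inv_closed : InvClosed S
  pairwise : ∀ ϱ ∈ F, ϱ.Pairwise fun r s => r ≤ s.inv
  small : ∀ x ∈ S, x ≤ x.inv → {x.inv} ∈ F
  separable : ∀ x ∈ S, ∀ y ∈ S, x ≤ y →
    ∃ e ∈ S, x ≤ e ∧ e ≤ y ∧ Shifts S F e x ∧ Shifts S F e.inv y.inv

variable {S : Set (OSep G)} {F : Set (Set (OSep G))} {D : Set (OSep G)}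

theorem Forced.mem (hS : InvClosed S) (hD : D ⊆ S) {z : OSep G} (hz : Forced S F D z) :
    z ∈ S := by
  cases hz with
  | hyp h => exact hD h
  | node _ h ht _ => exact hS _ (h ht)

theorem IsDual.forced_of_small (h : IsDual S F) {x : OSep G} (hx : x ∈ S) (hxx : x ≤ x.inv) :
    Forced S F D x := by
  have := Forced.node (D := D) (h.small x hx hxx)
    (by rintro _ rfl; exact h.inv_closed _ hx) (Set.mem_singleton _)
    (fun y hy hne => absurd hy hne)
  simpa using this

theorem Forced.cut {y z : OSep G} (hy : Forced S F D y) (hz : Forced S F (insert y D) z) :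
    Forced S F D z := by
  induction hz with
  | hyp hz =>
    rcases hz with rfl | hz
    · exact hy
    · exact .hyp hz
  | node hϱ hϱS ht _ ih => exact .node hϱ hϱS ht ih

/-- A separation forced with the help of a hypothesis `y` is forced without it or lies above `y`;
in the latter case the rooted tree can be rerooted at `y`. -/
theorem IsDual.forced_insert (h : IsDual S F) {y : OSep G} (hy : ¬ y ≤ y.inv)
    {z : OSep G} (hz : Forced S F (insert y D) z) :
    Forced S F D z ∨ (y ≤ z ∧ (Forced S F D z.inv → Forced S F D y.inv)) := by
  induction hz with
  | hyp hz =>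
    rcases hz with rfl | hz
    · exact Or.inr ⟨le_rfl, id⟩
    · exact Or.inl (.hyp hz)
  | @node ϱ t hϱ hϱS ht hx ih =>
    by_cases hall : ∀ x ∈ ϱ, x ≠ t → Forced S F D x
    · exact Or.inl (.node hϱ hϱS ht hall)
    push Not at hall
    obtain ⟨x₀, hx₀, hx₀t, hnot⟩ := hall
    obtain ⟨hyx, hre⟩ := (ih x₀ hx₀ hx₀t).resolve_left hnot
    refine Or.inr ⟨hyx.trans (h.pairwise ϱ hϱ hx₀ ht hx₀t), fun htf => ?_⟩
    refine hre (.node hϱ hϱS hx₀ fun x hxϱ hne => ?_)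
    by_cases hxt : x = t
    · subst hxt; simpa using htf
    · refine (ih x hxϱ hxt).resolve_right fun hh => hy ?_
      exact hyx.trans ((h.pairwise ϱ hϱ hx₀ hxϱ hne.symm).trans (OSep.inv_le_inv.2 hh.1))

theorem IsDual.forced_inv_of_refuted_insert (h : IsDual S F) {y : OSep G} (hy : y ∈ S)
    (hD : ¬ Refuted S F D) (href : Refuted S F (insert y D)) : Forced S F D y.inv := by
  rcases href with h0 | ⟨z, hz, hz'⟩
  · exact absurd (Or.inl h0) hD
  by_cases hsm : y ≤ y.inv
  · have hyf := h.forced_of_small (D := D) hy hsm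
    exact absurd (Or.inr ⟨z, hyf.cut hz, hyf.cut hz'⟩) hD
  rcases h.forced_insert hsm hz with h1 | h1 <;> rcases h.forced_insert hsm hz' with h2 | h2
  · exact absurd (Or.inr ⟨z, h1, h2⟩) hD
  · exact h2.2 h1
  · exact h1.2 h2
  · exact absurd (h1.1.trans (OSep.le_inv_comm.1 h2.1)) hsm

/-- The shift of a rooted tree. -/
theorem IsDual.forced_shift (h : IsDual S F) (hDS : D ⊆ S)
    (hlow : ∀ x ∈ S, ∀ y ∈ D, x ≤ y → x ∈ D) {e y : OSep G}
    (he : Shifts S F e y.inv) {z : OSep G} (hz : Forced S F D z) (hzy : z ≤ y) :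
    Forced S F D (e.inv ⊓ z) := by
  induction hz with
  | @hyp z hz =>
    refine .hyp (hlow _ ?_ z hz inf_le_right)
    have := h.inv_closed _ (he.sup_mem _ (h.inv_closed _ (hDS hz)) (OSep.inv_le_inv.2 hzy))
    exact this
  | @node ϱ t hϱ hϱS ht hx ih =>
    have hrt : y.inv ≤ t := OSep.inv_le_comm.1 hzy
    have hxy : ∀ x ∈ ϱ, x ≠ t → x ≤ y := fun x hxϱ hne =>
      (h.pairwise ϱ hϱ hxϱ ht hne).trans hzy
    by_cases hyϱ : y ∈ ϱ
    · by_cases hyt : y = t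
      · subst hyt
        exact h.forced_of_small (h.inv_closed _ (he.sup_mem y (hϱS ht) hrt))
          (inf_le_right.trans (hrt.trans (OSep.le_inv_comm.1 inf_le_right)))
      · have : y ≤ t.inv := h.pairwise ϱ hϱ hyϱ ht hyt
        rw [← this.antisymm hzy]
        exact ih y hyϱ hyt le_rfl
    have hsh := he.shift_mem ϱ hϱ hϱS t ht hrt hyϱ
    have hsub : shiftStar e t ϱ ⊆ S := by
      rintro _ (rfl | ⟨x, hx, rfl⟩)
      · exact he.sup_mem t (hϱS ht) hrt
      · exact h.inv_closed _ (he.sup_mem x.inv (h.inv_closed _ (hϱS hx.1))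
          (OSep.inv_le_inv.2 (hxy x hx.1 hx.2)))
    have := Forced.node (D := D) (t := e ⊔ t) hsh hsub (Or.inl rfl) ?_
    · exact this
    · rintro _ (rfl | ⟨x, hx, rfl⟩) hne
      · exact absurd rfl hne
      · exact ih x hx.1 hx.2 (hxy x hx.1 hx.2)

theorem IsDual.refuted_insert_of_le (h : IsDual S F) (hDS : D ⊆ S)
    (hlow : ∀ x ∈ S, ∀ y ∈ D, x ≤ y → x ∈ D) (hD : ¬ Refuted S F D) {x y : OSep G} (hx : x ∈ S)
    (hy : Forced S F D y) (hxy : x ≤ y) : ¬ Refuted S F (insert x D) := by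
  intro href
  have hxi := h.forced_inv_of_refuted_insert hx hD href
  obtain ⟨e, he, hxe, hey, h1, h2⟩ := h.separable x hx y (hy.mem h.inv_closed hDS) hxy
  have h3 := h.forced_shift hDS hlow h2 hy le_rfl
  have h4 := h.forced_shift hDS hlow (y := x.inv) (by simpa using h1) hxi le_rfl
  rw [OSep.inv_inv, inf_eq_left.2 hey] at h3
  rw [inf_eq_left.2 (OSep.inv_le_inv.2 hxe)] at h4
  exact hD (Or.inr ⟨e, h3, h4⟩)

/-- Tangle-tree duality for a finite set of separations. -/
theorem IsDual.exists_orientation (h : IsDual S F) (hS : S.Finite) (hr : ¬ Refuted S F ∅) :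
    ∃ O, IsDownOrientation S O ∧ Avoids O F := by
  let X : Set (Set (OSep G)) :=
    {D | D ⊆ S ∧ (∀ x ∈ S, ∀ y ∈ D, x ≤ y → x ∈ D) ∧ ¬ Refuted S F D}
  have hX : X.Finite := hS.finite_subsets.subset fun D hD => hD.1
  obtain ⟨D, ⟨hDS, hlow, hD⟩, hmax⟩ := hX.exists_maximal
    ⟨∅, Set.empty_subset _, fun _ _ _ hy => absurd hy (Set.notMem_empty _), hr⟩
  have hins : ∀ x ∈ S, (∀ y ∈ S, y < x → y ∈ D) → ¬ Refuted S F (insert x D) → x ∈ D := by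
    intro x hx hbelow hnr
    refine hmax ⟨Set.insert_subset hx hDS, ?_, hnr⟩ (Set.subset_insert _ _) (Set.mem_insert _ _)
    rintro a ha b (rfl | hb) hab
    · rcases hab.eq_or_lt with rfl | hlt
      · exact Set.mem_insert _ _
      · exact Set.mem_insert_of_mem _ (hbelow a ha hlt)
    · exact Set.mem_insert_of_mem _ (hlow a ha b hb hab)
  have hforced : ∀ y, Forced S F D y → ∀ x ∈ S, x ≤ y → x ∈ D := by
    intro y hy
    by_contra! hne
    obtain ⟨x₀, hx₀, hx₀y, hx₀D⟩ := hne
    obtain ⟨x, hx⟩ := (hS.subset (Set.sep_subset S fun x => x ≤ y ∧ x ∉ D)).exists_minimal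
      ⟨x₀, hx₀, hx₀y, hx₀D⟩
    refine hx.1.2.2 (hins x hx.1.1 (fun z hz hzx => ?_)
      (h.refuted_insert_of_le hDS hlow hD hx.1.1 hy hx.1.2.1))
    by_contra hzD
    exact hx.not_lt ⟨hz, hzx.le.trans hx.1.2.1, hzD⟩ hzx
  refine ⟨D, ⟨hDS, ?_, fun s hs hs' => hD (Or.inr ⟨s, .hyp hs, .hyp hs'⟩), hlow⟩, ?_⟩
  · by_contra! hne
    obtain ⟨x₀, hx₀, hx₀D⟩ := hne
    obtain ⟨x, hx⟩ := (hS.subset (Set.sep_subset S fun x => x ∉ D ∧ x.inv ∉ D)).exists_minimal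
      ⟨x₀, hx₀, hx₀D⟩
    refine hx.1.2.1 (hins x hx.1.1 (fun z hz hzx => ?_) fun href => ?_)
    · by_contra hzD
      refine hx.not_lt ⟨hz, hzD, fun hzi => ?_⟩ hzx
      exact hx.1.2.2 (hlow _ (h.inv_closed _ hx.1.1) _ hzi (OSep.inv_le_inv.2 hzx.le))
    · have := h.forced_inv_of_refuted_insert hx.1.1 hD href
      exact hx.1.2.2 (hforced _ this _ (h.inv_closed _ hx.1.1) le_rfl)
  · intro ϱ hϱ hϱD
    rcases ϱ.eq_empty_or_nonempty with rfl | ⟨t, ht⟩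
    · exact hD (Or.inl hϱ)
    · exact hD (Or.inr ⟨t, .hyp (hϱD ht),
        .node hϱ (hϱD.trans hDS) ht fun x hx _ => .hyp (hϱD hx)⟩)

end

section

variable {V : Type u} {G : SimpleGraph V} {k : ℕ} {F : Set (Set (OSep G))}

/-- The elements of `F` whose interior, if `k = 1`, lies in the interior of `τ`. -/
def traceFamily (k : ℕ) (F : Set (Set (OSep G))) (τ : Set (OSep G)) : Set (Set (OSep G)) :=
  {ϱ ∈ F | k = 1 → starInterior ϱ ⊆ starInterior τ}

theorem starInterior_eq_empty_of_lt {ϱ : Set (OSep G)} (h : (starInterior ϱ).encard < k)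
    (hk : k = 1) : starInterior ϱ = ∅ := by
  subst hk
  simpa using h

theorem mem_traceFamily_of_lt {ϱ : Set (OSep G)} (hϱ : ϱ ∈ F)
    (h : (starInterior ϱ).encard < k) (τ : Set (OSep G)) : ϱ ∈ traceFamily k F τ :=
  ⟨hϱ, fun hk => by simp [starInterior_eq_empty_of_lt h hk]⟩

theorem starInterior_singleton_cosmall (A : Set V) :
    starInterior {OSep.cosmall G A} = A := by
  ext; simp [starInterior]

theorem IsNice.cosmall_mem_traceFamily (hF : IsNice k F) {A : Set V} (hA : A.encard < k)
    (τ : Set (OSep G)) : {OSep.cosmall G A} ∈ traceFamily k F τ :=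
  mem_traceFamily_of_lt (hF.2.2.1 A hA) (by rwa [starInterior_singleton_cosmall]) τ

theorem IsNice.triple_mem_traceFamily (hF : IsNice k F) {s y : OSep G} (hs : s ∈ sepSys G k)
    (hy : y ∈ sepSys G k) (h1 : s.inv ⊓ y ∈ sepSys G k) (h2 : s.inv ⊓ y.inv ∈ sepSys G k)
    (h : (starInterior {s, s.inv ⊓ y, s.inv ⊓ y.inv}).encard < k) (τ : Set (OSep G)) :
    {s, s.inv ⊓ y, s.inv ⊓ y.inv} ∈ traceFamily k F τ := by
  refine mem_traceFamily_of_lt (hF.2.2.2 ⟨⟨?_, s, hs, y, hy, rfl⟩, h⟩) h τ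
  rintro _ (rfl | rfl | rfl) <;> assumption

theorem starInterior_shiftStar_subset {e t : OSep G} {ϱ : Set (OSep G)}
    (he : e.left ∩ e.right = ∅) :
    starInterior (shiftStar e t ϱ) ⊆ e.right ∩ starInterior ϱ := by
  intro v hv
  have h1 := hv (e ⊔ t) (Or.inl rfl)
  refine ⟨h1.1, fun x hx => ?_⟩
  by_cases hxt : x = t
  · rw [hxt]; exact h1.2
  · rcases hv (e.inv ⊓ x) (Or.inr ⟨x, ⟨hx, hxt⟩, rfl⟩) with h2 | h2
    · exact absurd (show v ∈ e.left ∩ e.right from ⟨h2, h1.1⟩) (by simp [he])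
    · exact h2

theorem left_inter_right_eq_empty {e : OSep G} (he : e ∈ sepSys G k) (hk : k = 1) :
    e.left ∩ e.right = ∅ := by
  subst hk
  simpa [mem_sepSys, OSep.order] using he

theorem shiftStar_mem_traceFamily {e t : OSep G} {ϱ τ : Set (OSep G)} (he : e ∈ sepSys G k)
    (hϱ : ϱ ∈ traceFamily k F τ) (h : shiftStar e t ϱ ∈ F) :
    shiftStar e t ϱ ∈ traceFamily k F (insert e τ) := by
  refine ⟨h, fun hk v hv => ?_⟩
  have h1 := starInterior_shiftStar_subset (left_inter_right_eq_empty he hk) hv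
  rintro s (rfl | hs)
  · exact h1.1
  · exact hϱ.2 hk h1.2 s hs

theorem starInterior_anti {σ τ : Set (OSep G)} (h : σ ⊆ τ) : starInterior τ ⊆ starInterior σ :=
  fun _ hv s hs => hv s (h hs)

theorem shiftStar_mem_traceFamily_self {e t : OSep G} {ϱ τ : Set (OSep G)} (he : e ∈ sepSys G k)
    (hϱ : ϱ ∈ traceFamily k F τ) (h : shiftStar e t ϱ ∈ F) :
    shiftStar e t ϱ ∈ traceFamily k F τ :=
  ⟨h, fun hk => ((shiftStar_mem_traceFamily he hϱ h).2 hk).trans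
    (starInterior_anti (Set.subset_insert _ _))⟩

theorem IsNice.shiftStar_mem (hF : IsNice k F) {e r t : OSep G} (he : e ∈ sepSys G k)
    (hr : r ∈ sepSys G (2 * k - 1)) (hem : Emulates (sepSys G k) e r) {ϱ : Set (OSep G)}
    (hϱ : ϱ ∈ F) (ht : t ∈ ϱ) (hrt : r ≤ t) (hrϱ : r.inv ∉ ϱ) : shiftStar e t ϱ ∈ F := by
  refine (hF.2.1 e he r hr hem).2 ϱ hϱ (fun x hx => ⟨⟨(hF.1 ϱ hϱ).2 hx, ?_⟩, ?_⟩) t ht hrt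
  · by_cases hxt : x = t
    · exact Or.inl (hxt ▸ hrt)
    · exact Or.inr (hrt.trans ((hF.1 ϱ hϱ).1.2.2 ht hx (Ne.symm hxt)))
  · rintro rfl; exact hrϱ hx

theorem shiftStar_singleton (e t : OSep G) : shiftStar e t {t} = {e ⊔ t} := by
  simp [shiftStar]

theorem sepSys_mono {k l : ℕ} (h : k ≤ l) : sepSys G k ⊆ sepSys G l :=
  fun _ hs => lt_of_lt_of_le (mem_sepSys.1 hs) (by exact_mod_cast h)

theorem pos_of_mem_sepSys {s : OSep G} (hs : s ∈ sepSys G k) : 1 ≤ k := by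
  rcases Nat.eq_zero_or_pos k with rfl | h
  · exact absurd hs (by simp [mem_sepSys])
  · exact h

variable {σ : Set (OSep G)}

theorem shifts_addInverses (hF : IsNice k F) {e r : OSep G} (he : e ∈ sepAbove k σ)
    (hr : r ∈ sepAbove k σ) (hem : Emulates (sepSys G k) e r) :
    Shifts (sepAbove k σ) (addInverses (traceFamily k F σ) σ) e r := by
  refine ⟨hem.2.1, fun z hz hrz => ⟨hem.2.2 z hz.1 hrz, sup_mem_nestedAbove he.2 hz.2⟩, ?_⟩
  rintro ϱ (hϱ | ⟨q, hq, rfl⟩) - t ht hrt hrϱ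
  · have hk := pos_of_mem_sepSys he.1
    exact Or.inl (shiftStar_mem_traceFamily_self he.1 hϱ (hF.shiftStar_mem he.1
      (sepSys_mono (by omega) hr.1) hem hϱ.1 ht hrt hrϱ))
  · obtain rfl : t = q.inv := ht
    rw [shiftStar_singleton]
    rcases he.2 q hq with h | h
    · left
      have heq := OSep.eq_cosmall_of_inv_le (s := e ⊔ q.inv)
        (show e.inv ⊓ q ≤ e ⊔ q.inv from inf_le_right.trans (h.trans le_sup_left))
      rw [heq]
      refine hF.cosmall_mem_traceFamily (lt_of_le_of_lt (Set.encard_le_encard ?_) he.1) σ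
      exact fun v hv => ⟨h.1 hv.2, hv.1⟩
    · exact Or.inr ⟨q, hq, by rw [sup_eq_right.2 (OSep.le_inv_comm.1 h)]⟩

theorem isDual_sepAbove (hF : IsNice k F) (hσ : IsStar σ) (hfin : σ.Finite)
    (hunc : ∀ s ∈ σ, Uncrosses k s) :
    IsDual (sepAbove k σ) (addInverses (traceFamily k F σ) σ) := by
  refine ⟨invClosed_sepAbove σ, ?_, ?_, ?_⟩
  · rintro ϱ (hϱ | ⟨q, hq, rfl⟩)
    · exact (hF.1 ϱ hϱ.1).1.2.2
    · exact Set.pairwise_singleton _ _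
  · intro x hx hxx
    have h := OSep.eq_cosmall_of_inv_le (s := x.inv) hxx
    rw [h]
    refine Or.inl (hF.cosmall_mem_traceFamily ?_ σ)
    rw [← OSep.order_cosmall (G := G), ← h, OSep.order_inv]
    exact hx.1
  · intro x hx y hy hxy
    obtain ⟨e, he, h1, h2, h3, h4⟩ := exists_emulates hfin hσ.2.2 hunc hx hy hxy
    exact ⟨e, he, h1, h2, shifts_addInverses hF he hx h3,
      shifts_addInverses hF (invClosed_sepAbove _ _ he) (invClosed_sepAbove _ _ hy) h4⟩

/-- A notion `H` of separations that are *big* on their left side, as seen from `s`. It allows to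
extend tangles of `sepAbove k (insert s τ)` to tangles of `sepAbove k τ`. -/
structure IsGuide (k : ℕ) (F : Set (Set (OSep G))) (s : OSep G) (H : OSep G → Prop) : Prop where
  total : ∀ y ∈ sepSys G k, H y ∨ H y.inv
  mono : ∀ y ∈ sepSys G k, ∀ z ∈ sepSys G k, y ≤ z → H y → H z
  sup_mem : ∀ y ∈ sepSys G k, H y → s ⊔ y ∈ sepSys G k
  small : ∀ y ∈ sepSys G k, H y → H y.inv →
    (starInterior {s, s.inv ⊓ y, s.inv ⊓ y.inv}).encard < k
  shift : ∀ ϱ ∈ F, (∀ A : Set V, A.encard < k → OSep.cosmall G A ∉ ϱ) → (∀ x ∈ ϱ, x.inv ∉ ϱ) →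
    s = OSep.cosmall G ∅ ∨ ∃ t ∈ ϱ, H t ∧ shiftStar s t ϱ ∈ F

theorem IsGuide.inf_mem {s : OSep G} {H : OSep G → Prop} (hH : IsGuide k F s H) {y : OSep G}
    (hy : y ∈ sepSys G k) (h : H y.inv) : s.inv ⊓ y ∈ sepSys G k :=
  inv_mem_sepSys.1 (hH.sup_mem _ (inv_mem_sepSys.2 hy) h)

theorem IsGuide.uncrosses {s : OSep G} {H : OSep G → Prop} (hH : IsGuide k F s H) :
    Uncrosses k s :=
  fun y hy => (hH.total y hy).imp (hH.sup_mem y hy) (hH.inf_mem hy)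

theorem IsNice.cosmall_notMem (hF : IsNice k F) {O τ : Set (OSep G)}
    (hA : Avoids O (addInverses (traceFamily k F τ) σ)) {A : Set V}
    (h : A.encard < k) : OSep.cosmall G A ∉ O :=
  fun hmem => hA _ (Or.inl (hF.cosmall_mem_traceFamily h τ)) (by simpa using hmem)

/-- Extending a tangle by uncrossing from `s`. -/
theorem IsGuide.exists_extension (hF : IsNice k F) (hσ : IsStar σ) (hσk : σ ⊆ sepSys G k)
    {s : OSep G} (hs : s ∈ σ) {H : OSep G → Prop} (hH : IsGuide k F s H) {τ : Set (OSep G)}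
    (hτ : τ ⊆ σ) {O : Set (OSep G)} (hO : IsDownOrientation (sepAbove k (insert s τ)) O)
    (hA : Avoids O (addInverses (traceFamily k F (insert s τ)) σ)) :
    ∃ O', IsDownOrientation (sepAbove k τ) O' ∧
      Avoids O' (addInverses (traceFamily k F τ) σ) := by
  have hins : insert s τ ⊆ σ := Set.insert_subset hs hτ
  have hσS : σ ⊆ sepAbove k (insert s τ) := fun q hq =>
    ⟨hσk hq, hσ.subset_nestedAbove hins hq⟩
  have hσO : ∀ q ∈ σ, q ∈ O := fun q hq => (hO.total q (hσS hq)).resolve_right fun h =>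
    hA {q.inv} (Or.inr ⟨q, hq, rfl⟩) (by simpa using h)
  have hsτ : s ∈ nestedAbove τ := hσ.subset_nestedAbove hτ hs
  have hnest : ∀ y ∈ nestedAbove τ, s ⊔ y ∈ nestedAbove (insert s τ) := by
    rintro y hy t (rfl | ht)
    · exact Or.inl le_sup_left
    · exact sup_mem_nestedAbove hsτ hy t ht
  have hsup : ∀ y ∈ sepAbove k τ, H y → s ⊔ y ∈ sepAbove k (insert s τ) :=
    fun y hy hHy => ⟨hH.sup_mem y hy.1 hHy, hnest y hy.2⟩
  have hinf : ∀ y ∈ sepAbove k τ, H y.inv → s.inv ⊓ y ∈ sepAbove k (insert s τ) := by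
    intro y hy hHy
    exact invClosed_sepAbove _ _ (hsup y.inv (invClosed_sepAbove _ _ hy) hHy)
  have hle : ∀ x y : OSep G, x ≤ y → s.inv ⊓ x ≤ s ⊔ y := fun x y h =>
    inf_le_right.trans (h.trans le_sup_right)
  have htriple : ∀ y ∈ sepAbove k τ,
      (starInterior {s, s.inv ⊓ y, s.inv ⊓ y.inv}).encard < k →
      s.inv ⊓ y ∈ O → s.inv ⊓ y.inv ∉ O := by
    intro y hy h1 h3 h4
    refine hA _ (Or.inl (hF.triple_mem_traceFamily (hσk hs) hy.1 (hO.subset h3).1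
      (hO.subset h4).1 h1 _)) ?_
    rintro _ (rfl | rfl | rfl)
    exacts [hσO _ hs, h3, h4]
  have hcosO : ∀ A : Set V, A.encard < k → OSep.cosmall G A ∉ O :=
    fun A h => hF.cosmall_notMem hA h
  let O' : Set (OSep G) :=
    {y ∈ sepAbove k τ | (H y ∧ s ⊔ y ∈ O) ∨ (H y.inv ∧ s.inv ⊓ y ∈ O)}
  have hO'inf : ∀ y ∈ O', H y.inv → s.inv ⊓ y ∈ O := by
    rintro y ⟨hy, ⟨-, h⟩ | ⟨-, h⟩⟩ hHy
    · exact hO.lower _ (hinf y hy hHy) _ h (hle y y le_rfl)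
    · exact h
  have hO'sup : ∀ y ∈ O', H y → s ⊔ y ∈ O := by
    rintro y ⟨hy, ⟨-, h⟩ | ⟨h', h⟩⟩ hHy
    · exact h
    · refine (hO.total _ (hsup y hy hHy)).resolve_right fun h2 => ?_
      exact htriple y hy (hH.small y hy.1 hHy h') h h2
  have hdown : IsDownOrientation (sepAbove k τ) O' := by
    refine ⟨Set.sep_subset _ _, ?_, ?_, ?_⟩
    · intro y hy
      have hyi := invClosed_sepAbove _ _ hy
      rcases hH.total y hy.1 with h | h
      · rcases hO.total _ (hsup y hy h) with h1 | h1
        · exact Or.inl ⟨hy, Or.inl ⟨h, h1⟩⟩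
        · exact Or.inr ⟨hyi, Or.inr ⟨h, h1⟩⟩
      · rcases hO.total _ (hinf y hy h) with h1 | h1
        · exact Or.inl ⟨hy, Or.inr ⟨h, h1⟩⟩
        · exact Or.inr ⟨hyi, Or.inl ⟨h, h1⟩⟩
    · intro y hy hyi
      rcases hH.total y hy.1.1 with h | h
      · exact hO.not_both _ (hO'sup y hy h) (hO'inf _ hyi h)
      · exact hO.not_both _ (hO'sup _ hyi h) (hO'inf _ hy h)
    · intro x hx y hy hxy
      have hyS := hy.1
      rcases hH.total x hx.1 with h | h
      · have h1 := hO'sup y hy (hH.mono x hx.1 y hyS.1 hxy h)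
        exact ⟨hx, Or.inl ⟨h, hO.lower _ (hsup x hx h) _ h1 (sup_le_sup_left hxy s)⟩⟩
      · refine ⟨hx, Or.inr ⟨h, ?_⟩⟩
        rcases hy.2 with ⟨h1, h2⟩ | ⟨h1, h2⟩
        · exact hO.lower _ (hinf x hx h) _ h2 (hle x y hxy)
        · exact hO.lower _ (hinf x hx h) _ h2 (inf_le_inf_left _ hxy)
  refine ⟨O', hdown, ?_⟩
  rintro ϱ (hϱ | ⟨q, hq, rfl⟩) hϱO
  · have hcos : ∀ A : Set V, A.encard < k → OSep.cosmall G A ∉ O' := by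
      intro A hAk hmem
      set y := OSep.cosmall G A with hy
      have hz : s ⊔ y = OSep.cosmall G (s.right ∩ A) := by
        ext v <;> simp [hy]
      have hlt : (s.right ∩ A).encard < k := (Set.encard_le_encard Set.inter_subset_right).trans_lt
        hAk
      have hzO : s ⊔ y ∉ O := hz ▸ hcosO _ hlt
      rcases hmem.2 with ⟨-, h⟩ | ⟨-, h⟩
      · exact hzO h
      · have hzS : s ⊔ y ∈ sepAbove k (insert s τ) :=
          ⟨by rw [hz, mem_sepSys, OSep.order_cosmall]; exact hlt, hnest y hmem.1.2⟩
        refine htriple y hmem.1 ?_ h ((hO.total _ hzS).resolve_left hzO)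
        refine lt_of_le_of_lt (Set.encard_le_encard fun v hv => ?_) (hO.subset h).1
        have h1 := hv s (by simp)
        have h2 := hv (s.inv ⊓ y) (by simp)
        exact ⟨⟨h1, trivial⟩, h2⟩
    rcases hH.shift ϱ hϱ.1 (fun A hAk hmem => hcos A hAk (hϱO hmem))
      (fun x hx hxi => hdown.not_both x (hϱO hx) (hϱO hxi)) with h | ⟨t, ht, hHt, hsh⟩
    · have hk : 0 < k := pos_of_mem_sepSys (hσk hs)
      exact hcosO ∅ (by simpa using hk) (h ▸ hσO s hs)
    · refine hA _ (Or.inl (shiftStar_mem_traceFamily (hσk hs) hϱ hsh)) ?_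
      rintro _ (rfl | ⟨x, hx, rfl⟩)
      · exact hO'sup t (hϱO ht) hHt
      · refine hO'inf x (hϱO hx.1) (hH.mono t (hϱO ht).1.1 _ (inv_mem_sepSys.2 (hϱO hx.1).1.1)
          ((hF.1 ϱ hϱ.1).1.2.2 ht hx.1 (Ne.symm hx.2)) hHt)
  · refine hdown.not_both q ?_ (by simpa using hϱO)
    have hqS : q ∈ sepAbove k τ := ⟨hσk hq, hσ.subset_nestedAbove hτ hq⟩
    by_cases hqs : q = s
    · subst hqs
      refine ⟨hqS, ?_⟩
      rcases hH.total q hqS.1 with h | h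
      · exact Or.inl ⟨h, by rw [sup_idem]; exact hσO q hq⟩
      · refine Or.inr ⟨h, (hO.total _ (hinf q hqS h)).resolve_right fun h' => ?_⟩
        have heq := OSep.eq_cosmall_of_inv_le (s := (q.inv ⊓ q).inv)
          (show q.inv ⊓ q ≤ q ⊔ q.inv from inf_le_right.trans le_sup_left)
        rw [heq] at h'
        refine hcosO _ (lt_of_le_of_lt (Set.encard_le_encard fun v hv => ?_) (hσk hq)) h'
        exact hv.symm
    · have hqs' : q ≤ s.inv := hσ.2.2 hq hs hqs
      have hqO : s.inv ⊓ q ∈ O := by rw [inf_eq_right.2 hqs']; exact hσO q hq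
      refine ⟨hqS, ?_⟩
      rcases hH.total q hqS.1 with h | h
      · refine Or.inl ⟨h, (hO.total _ (hsup q hqS h)).resolve_right fun h' => ?_⟩
        refine htriple q hqS (lt_of_le_of_lt (Set.encard_le_encard fun v hv => ?_)
          (hsup q hqS h).1) hqO h'
        have h1 := hv s (by simp)
        have h2 := hv (s.inv ⊓ q) (by simp)
        have h3 := hv (s.inv ⊓ q.inv) (by simp)
        have h4 : v ∈ s.left → v ∈ q.right := fun hv => hqs'.2 hv
        simp at h1 h2 h3 ⊢
        tauto
      · exact Or.inr ⟨h, hqO⟩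

/-- Extending a tangle of the separations nested with `σ` to all separations of order `< k`. -/
theorem exists_extension (hF : IsNice k F) (hσ : IsStar σ) (hσk : σ ⊆ sepSys G k)
    (hfin : σ.Finite) (hH : ∀ s ∈ σ, ∃ H, IsGuide k F s H) {O : Set (OSep G)}
    (hO : IsDownOrientation (sepAbove k σ) O)
    (hA : Avoids O (addInverses (traceFamily k F σ) σ)) :
    ∃ O', IsTangle (sepSys G k) (addInverses F σ) O' := by
  have key : ∀ τ : Set (OSep G), τ.Finite → τ ⊆ σ → (∃ O, IsDownOrientation (sepAbove k τ) O ∧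
      Avoids O (addInverses (traceFamily k F τ) σ)) → ∃ O, IsDownOrientation (sepAbove k ∅) O ∧
      Avoids O (addInverses (traceFamily k F ∅) σ) := by
    intro τ hτ
    induction τ, hτ using Set.Finite.induction_on with
    | empty => exact fun _ h => h
    | @insert s τ _ _ ih =>
      rintro hsub ⟨O, hO, hA⟩
      have hs := hsub (Set.mem_insert _ _)
      have hτ := (Set.subset_insert s τ).trans hsub
      obtain ⟨H, hH⟩ := hH s hs
      exact ih hτ (hH.exists_extension hF hσ hσk hs hτ hO hA)
  obtain ⟨O', hO', hA'⟩ := key σ hfin subset_rfl ⟨O, hO, hA⟩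
  have h1 : sepAbove k (∅ : Set (OSep G)) = sepSys G k := by
    ext; simp [sepAbove, nestedAbove]
  have h2 : traceFamily k F ∅ = F := by
    ext; simp [traceFamily, starInterior]
  rw [h1] at hO'
  rw [h2] at hA'
  exact ⟨O', hO'.isOrientation, hO'.isConsistent (fun _ => inv_mem_sepSys.2), hA'⟩

end

section

variable {V : Type u} {G : SimpleGraph V} {k : ℕ} {F : Set (Set (OSep G))}

theorem sup_mem_of_inf_notMem {s t : OSep G} (hs : s ∈ sepSys G k) (ht : t ∈ sepSys G k)
    (h : s ⊓ t ∉ sepSys G k) : s ⊔ t ∈ sepSys G k :=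
  (sup_mem_or_inf_mem hs ht).resolve_right h

theorem inf_mem_sepSys_two_mul {s t : OSep G} (hs : s ∈ sepSys G k) (ht : t ∈ sepSys G k) :
    s ⊓ t ∈ sepSys G (2 * k - 1) := by
  have h := OSep.order_sup_add_order_inf_le s t
  have hk := pos_of_mem_sepSys hs
  rw [mem_sepSys] at *
  have h3 : (s ⊓ t).order ≤ s.order + t.order := le_add_self.trans h
  obtain ⟨a, ha⟩ := ENat.ne_top_iff_exists.1 (hs.trans_le le_top).ne
  obtain ⟨b, hb⟩ := ENat.ne_top_iff_exists.1 (ht.trans_le le_top).ne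
  rw [← ha, ← hb] at h3
  rw [← ha] at hs
  rw [← hb] at ht
  refine h3.trans_lt ?_
  norm_cast at *
  omega

/-- If `s.inv` is closely related to a profile containing `t.inv`, then `s` emulates `s ⊓ t`. -/
theorem IsCloselyRelated.emulates {P : Set (OSep G)} {s t : OSep G}
    (hd : IsDownOrientation (sepSys G k) P) (hP : ∀ r ∈ P, ∀ s ∈ P, (r ⊔ s).inv ∉ P)
    (hs : IsCloselyRelated k s.inv P) (ht : t.inv ∈ P) : Emulates (sepSys G k) s (s ⊓ t) := by
  have hsk : s ∈ sepSys G k := inv_mem_sepSys.1 (hd.subset hs.1)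
  have htk : t ∈ sepSys G k := inv_mem_sepSys.1 (hd.subset ht)
  refine ⟨hsk, inf_le_left, fun z hz hrz => ?_⟩
  rcases hd.total z hz with hzP | hzP
  · by_contra hsz
    have hq : s ⊓ z ∈ sepSys G k := (sup_mem_or_inf_mem hsk hz).resolve_left hsz
    have hqP : s ⊓ z ∈ P := hd.lower _ hq z hzP inf_le_right
    by_cases hr : s ⊓ t ∈ sepSys G k
    · exact hP _ hs.1 _ ht (hd.lower _ hr z hzP hrz)
    · have hqt : (s ⊓ z) ⊓ t = s ⊓ t :=
        le_antisymm (inf_le_inf_right _ inf_le_left)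
          (le_inf (le_inf inf_le_left hrz) inf_le_right)
      have h1 : (s ⊓ z) ⊔ t ∈ sepSys G k := sup_mem_of_inf_notMem hq htk (hqt ▸ hr)
      have h2 : ((s ⊓ z) ⊔ t).inv ∈ P :=
        hd.lower _ (inv_mem_sepSys.2 h1) _ ht (OSep.inv_le_inv.2 le_sup_right)
      refine hP _ hs.1 _ h2 ?_
      have h3 : (s.inv ⊔ ((s ⊓ z) ⊔ t).inv).inv = s ⊓ z := by
        change s ⊓ ((s ⊓ z) ⊔ t) = s ⊓ z
        rw [inf_sup_left]
        refine le_antisymm (sup_le inf_le_right (le_inf inf_le_left hrz)) ?_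
        exact (le_inf inf_le_left le_rfl).trans le_sup_left
      rwa [h3]
  · have := hs.2 _ hzP
    rwa [← OSep.inv_sup, inv_mem_sepSys] at this

theorem IsNice.isGuide_of_profile (hF : IsNice k F) {P : Set (OSep G)} (hP : IsProfile k P)
    (hA : Avoids P F) {s : OSep G} (hs : IsCloselyRelated k s.inv P) :
    IsGuide k F s fun y => y.inv ∈ P := by
  have hd := isDownOrientation_of_isConsistent hF hP.1 hP.2.1 hA
  refine ⟨?_, ?_, ?_, ?_, ?_⟩
  · exact fun y hy => (hd.total y hy).symm
  · exact fun y _ z hz hyz h => hd.lower _ (inv_mem_sepSys.2 hz) _ h (OSep.inv_le_inv.2 hyz)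
  · intro y _ h
    have := hs.2 _ h
    rwa [← OSep.inv_sup, inv_mem_sepSys] at this
  · exact fun y _ h h' => absurd h (hd.not_both _ h')
  · intro ϱ hϱ hcos hinv
    obtain ⟨t, ht, htP⟩ := Set.not_subset.1 (hA ϱ hϱ)
    have htk := (hF.1 ϱ hϱ).2 ht
    have htP := (hd.total t htk).resolve_left htP
    have hsk : s ∈ sepSys G k := inv_mem_sepSys.1 (hd.subset hs.1)
    refine Or.inr ⟨t, ht, htP, hF.shiftStar_mem hsk (inf_mem_sepSys_two_mul hsk htk)
      (hs.emulates hd hP.2.2 htP) hϱ ht inf_le_right fun hr => ?_⟩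
    by_cases hrt : (s ⊓ t).inv = t
    · have h1 : t.inv ≤ t := by
        have : s ⊓ t = t.inv := OSep.inv_injective hrt
        exact this ▸ inf_le_right
      have h2 := OSep.eq_cosmall_of_inv_le h1
      refine hcos t.right ?_ (h2 ▸ ht)
      rw [← OSep.order_cosmall (G := G), ← h2]
      exact htk
    · have h1 : t ≤ s ⊓ t := (hF.1 ϱ hϱ).1.2.2 ht hr (Ne.symm hrt)
      exact hinv t ht (by rwa [le_antisymm inf_le_right h1] at hr)

/-- A walk from the left to the right side of a separation meets the separator. -/
theorem exists_mem_support_separator (t : OSep G) {u v : V} (p : G.Walk u v) (hu : u ∈ t.left)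
    (hv : v ∈ t.right) : ∃ w ∈ p.support, w ∈ t.left ∩ t.right := by
  induction p with
  | nil => exact ⟨_, by simp, hu, hv⟩
  | @cons u w v h p ih =>
    by_cases hur : u ∈ t.right
    · exact ⟨u, by simp, hu, hur⟩
    by_cases hw : w ∈ t.left
    · obtain ⟨x, hx, hxt⟩ := ih hw hv
      exact ⟨x, by simp [hx], hxt⟩
    · exact absurd h (t.no_edge u ⟨hu, hur⟩ w ⟨(t.mem_or_mem w).resolve_left hw, hw⟩)

theorem exists_mem_support_separator' (t : OSep G) {u v x : V} (p : G.Walk u v)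
    (hx : x ∈ p.support) (hxl : x ∈ t.left) (hv : v ∈ t.right) :
    ∃ w ∈ p.support, w ∈ t.left ∩ t.right := by
  classical
  obtain ⟨w, hw, h⟩ := exists_mem_support_separator t (p.dropUntil x hx) hxl hv
  exact ⟨w, p.support_dropUntil_subset_support hx hw, h⟩

/-- A system of disjoint paths in `G[A]` ending in the vertices of `A ∩ B`, where `s = (A, B)`. -/
structure IsLinkage (s : OSep G) (a : V → V) (P : ∀ x, G.Walk (a x) x) : Prop where
  subset : ∀ x ∈ s.left ∩ s.right, ∀ v ∈ (P x).support, v ∈ s.left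
  disjoint : ∀ x ∈ s.left ∩ s.right, ∀ y ∈ s.left ∩ s.right, x ≠ y →
    ∀ v ∈ (P x).support, v ∉ (P y).support

/-- Every path of the linkage meets the left side of `y`. -/
def Hits (s : OSep G) {a : V → V} (P : ∀ x, G.Walk (a x) x) (y : OSep G) : Prop :=
  ∀ x ∈ s.left ∩ s.right, ∃ v ∈ (P x).support, v ∈ y.left

/-- Uncrossing along a linkage. -/
theorem IsLinkage.encard_union_le {s : OSep G} {a : V → V} {P : ∀ x, G.Walk (a x) x}
    (hP : IsLinkage s a P) {y : OSep G} {X : Set V} (hX : X ⊆ s.left ∩ s.right)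
    (hXy : ∀ x ∈ X, ∃ v ∈ (P x).support, v ∈ y.left ∩ y.right) :
    (X ∪ (s.right ∩ (y.left ∩ y.right))).encard ≤ y.order := by
  classical
  choose! g hg using hXy
  let f : V → V := fun v => if v ∈ y.left ∩ y.right then v else g v
  have hgr : ∀ x ∈ X, x ∉ y.left ∩ y.right → g x ∉ s.right := by
    intro x hx hxy hgx
    have h1 : g x ∈ s.left := hP.subset x (hX hx) _ (hg x hx).1
    have h2 : g x ≠ x := fun h => hxy (h ▸ (hg x hx).2)
    exact hP.disjoint x (hX hx) (g x) ⟨h1, hgx⟩ h2.symm _ (hg x hx).1 (by simp)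
  have hmem : ∀ v ∈ X ∪ (s.right ∩ (y.left ∩ y.right)), v ∉ y.left ∩ y.right → v ∈ X :=
    fun v hv hvy => hv.resolve_right fun h => hvy h.2
  have hr : ∀ v ∈ X ∪ (s.right ∩ (y.left ∩ y.right)), v ∈ s.right :=
    fun v hv => hv.elim (fun h => (hX h).2) fun h => h.1
  have hf : Set.MapsTo f (X ∪ (s.right ∩ (y.left ∩ y.right))) (y.left ∩ y.right) := by
    intro v hv
    by_cases hvy : v ∈ y.left ∩ y.right
    · simpa only [f, if_pos hvy] using hvy
    · simpa only [f, if_neg hvy] using (hg v (hmem v hv hvy)).2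
  have hinj : Set.InjOn f (X ∪ (s.right ∩ (y.left ∩ y.right))) := by
    intro v hv w hw hvw
    by_cases hvy : v ∈ y.left ∩ y.right <;> by_cases hwy : w ∈ y.left ∩ y.right
    · simpa only [f, if_pos hvy, if_pos hwy] using hvw
    · simp only [f, if_pos hvy, if_neg hwy] at hvw
      exact absurd (hvw ▸ hr v hv) (hgr w (hmem w hw hwy) hwy)
    · simp only [f, if_neg hvy, if_pos hwy] at hvw
      exact absurd (hvw ▸ hr w hw) (hgr v (hmem v hv hvy) hvy)
    · simp only [f, if_neg hvy, if_neg hwy] at hvw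
      by_contra hne
      have hv' := hmem v hv hvy
      have hw' := hmem w hw hwy
      exact hP.disjoint v (hX hv') w (hX hw') hne _ (hg v hv').1 (hvw ▸ (hg w hw').1)
  exact Set.encard_le_encard_of_injOn hf hinj

theorem IsLinkage.sup_mem {s : OSep G} {a : V → V} {P : ∀ x, G.Walk (a x) x}
    (hP : IsLinkage s a P) {y : OSep G} (hy : y ∈ sepSys G k) (h : Hits s P y) :
    s ⊔ y ∈ sepSys G k := by
  refine lt_of_le_of_lt (le_trans (Set.encard_le_encard ?_)
    (hP.encard_union_le (X := s.left ∩ s.right ∩ y.right) Set.inter_subset_left ?_)) hy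
  · rintro v ⟨h1 | h1, h2, h3⟩
    · exact Or.inl ⟨⟨h1, h2⟩, h3⟩
    · exact Or.inr ⟨h2, h1, h3⟩
  · intro x hx
    obtain ⟨v, hv, hvy⟩ := h x hx.1
    exact exists_mem_support_separator' y (P x) hv hvy hx.2

theorem IsLinkage.small {s : OSep G} {a : V → V} {P : ∀ x, G.Walk (a x) x}
    (hP : IsLinkage s a P) {y : OSep G} (hy : y ∈ sepSys G k) (h : Hits s P y)
    (h' : Hits s P y.inv) : (starInterior {s, s.inv ⊓ y, s.inv ⊓ y.inv}).encard < k := by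
  refine lt_of_le_of_lt (le_trans (Set.encard_le_encard ?_)
    (hP.encard_union_le (X := s.left ∩ s.right) subset_rfl ?_)) hy
  · intro v hv
    have h1 := hv s (by simp)
    have h2 := hv (s.inv ⊓ y) (by simp)
    have h3 := hv (s.inv ⊓ y.inv) (by simp)
    simp at h1 h2 h3 ⊢
    tauto
  · intro x hx
    rcases y.mem_or_mem x with hxy | hxy
    · obtain ⟨v, hv, hvy⟩ := h' x hx
      obtain ⟨w, hw, hwy⟩ := exists_mem_support_separator' y.inv (P x) hv hvy hxy
      exact ⟨w, hw, hwy.symm⟩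
    · obtain ⟨v, hv, hvy⟩ := h x hx
      exact exists_mem_support_separator' y (P x) hv hvy hxy

theorem IsNice.shiftStar_mem_of_hits (hF : IsNice k F) {s : OSep G} {a : V → V}
    {P : ∀ x, G.Walk (a x) x} (hP : IsLinkage s a P) (hs : s ∈ sepSys G k)
    {ϱ : Set (OSep G)} (hϱ : ϱ ∈ F) (hcos : ∀ A : Set V, A.encard < k → OSep.cosmall G A ∉ ϱ)
    {t : OSep G} (ht : t ∈ ϱ) (h : Hits s P t) : shiftStar s t ϱ ∈ F := by
  choose! p hp using h
  let X := p '' (s.left ∩ s.right)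
  have hX : X.encard < k := (Set.encard_image_le _ _).trans_lt hs
  have hk := pos_of_mem_sepSys hs
  have hr : (OSep.cosmall G X).inv ∈ sepSys G k := by
    rw [inv_mem_sepSys, mem_sepSys, OSep.order_cosmall]; exact hX
  refine hF.shiftStar_mem hs (r := (OSep.cosmall G X).inv) (sepSys_mono (by omega) hr)
    ⟨hs, ⟨?_, Set.subset_univ _⟩, fun z hz hrz => ?_⟩ hϱ ht ⟨?_, Set.subset_univ _⟩ (hcos X hX)
  · rintro _ ⟨x, hx, rfl⟩
    exact hP.subset x hx _ (hp x hx).1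
  · exact hP.sup_mem hz fun x hx => ⟨p x, (hp x hx).1, hrz.1 ⟨x, hx, rfl⟩⟩
  · rintro _ ⟨x, hx, rfl⟩
    exact (hp x hx).2

end

section

variable {V : Type u} {G : SimpleGraph V} {k m : ℕ} {F : Set (Set (OSep G))}

/-- `U` is joined to each path of the linkage `P` by fans, represented by the vertex sets `Q x w` of
their paths. -/
structure IsFanned (s : OSep G) {a : V → V} (P : ∀ x, G.Walk (a x) x) (U : Set V)
    (Q : V → V → Set V) : Prop where
  separator : ∀ x ∈ s.left ∩ s.right, ∀ w ∈ U, ∀ y : OSep G, w ∈ y.left →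
    (∀ v ∈ (P x).support, v ∉ y.left) → ∃ v ∈ Q x w, v ∈ y.left ∩ y.right
  disjoint : ∀ x ∈ s.left ∩ s.right, ∀ w ∈ U, ∀ w' ∈ U, w ≠ w' →
    ∀ v ∈ Q x w, v ∈ Q x w' → v ∈ (P x).support

theorem IsLeftRobust.exists_isFanned {ℓ : ℕ} {s : OSep G} (hs : IsLeftRobust ℓ s) :
    ∃ U ⊆ s.left, U.encard = ℓ ∧ ∃ (a : V → V) (P : ∀ x, G.Walk (a x) x) (Q : V → V → Set V),
      IsLinkage s a P ∧ IsFanned s P U Q := by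
  obtain ⟨-, U, hU, hUℓ, a, P, h1, h2, h3⟩ := hs
  have h4 : ∀ x ∈ s.left ∩ s.right, ∃ Q : V → Set V,
      (∀ w ∈ U, ∀ y : OSep G, w ∈ y.left → (∀ v ∈ (P x).support, v ∉ y.left) →
        ∃ v ∈ Q w, v ∈ y.left ∩ y.right) ∧
      ∀ w ∈ U, ∀ w' ∈ U, w ≠ w' → ∀ v ∈ Q w, v ∈ Q w' → v ∈ (P x).support := by
    intro x hx
    obtain ⟨b, Q, hQ, hQd⟩ := h3 x hx
    have hb : ∀ w ∈ U, b w ∈ (P x).support := fun w hw =>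
      ((hQ w hw).2.2.2 (b w) (by simp)).2 rfl
    refine ⟨fun w => {v | v ∈ (Q w).support}, fun w hw y hwy hPy => ?_, ?_⟩
    · exact exists_mem_support_separator y (Q w) hwy
        ((y.mem_or_mem _).resolve_left (hPy _ (hb w hw)))
    · intro w hw w' hw' hne v hv hv'
      rw [(hQd w hw w' hw' hne v hv hv').1]
      exact hb w hw
  choose! Q hQ using h4
  exact ⟨U, hU, hUℓ, a, P, Q, ⟨fun x hx => (h1 x hx).2, h2⟩,
    ⟨fun x hx => (hQ x hx).1, fun x hx => (hQ x hx).2⟩⟩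

variable {s : OSep G} {a : V → V} {P : ∀ x, G.Walk (a x) x} {U : Set V} {Q : V → V → Set V}

theorem IsFanned.encard_inter_left_le (hQ : IsFanned s P U Q) {y : OSep G} (hy : ¬ Hits s P y) :
    (U ∩ y.left).encard ≤ y.order := by
  simp only [Hits, not_forall, not_exists, not_and] at hy
  obtain ⟨x, hx, hy⟩ := hy
  have h := fun w (hw : w ∈ U ∩ y.left) => hQ.separator x hx w hw.1 y hw.2 hy
  choose! g hg using h
  refine Set.encard_le_encard_of_injOn (f := g) (fun w hw => (hg w hw).2) ?_
  intro w hw w' hw' hww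
  by_contra hne
  exact hy _ (hQ.disjoint x hx w hw.1 w' hw'.1 hne _ (hg w hw).1 (hww ▸ (hg w' hw').1))
    (hg w hw).2.1

theorem IsFanned.hits_or_hits (hQ : IsFanned s P U Q) (hU : 2 * (k - 1) < U.encard)
    {y : OSep G} (hy : y ∈ sepSys G k) : Hits s P y ∨ Hits s P y.inv := by
  by_contra! h
  have h1 := hQ.encard_inter_left_le h.1
  have h2 := hQ.encard_inter_left_le h.2
  rw [OSep.order_inv] at h2
  have h3 : U ⊆ (U ∩ y.left) ∪ (U ∩ y.inv.left) := fun v hv =>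
    (y.mem_or_mem v).imp (fun h => ⟨hv, h⟩) fun h => ⟨hv, h⟩
  have h4 := (Set.encard_le_encard h3).trans ((Set.encard_union_le _ _).trans (add_le_add h1 h2))
  obtain ⟨n, hn⟩ := ENat.ne_top_iff_exists.1 (order_lt_top hy).ne
  rw [mem_sepSys, ← hn] at hy
  rw [← hn] at h4
  have h5 := hU.trans_le h4
  norm_cast at *
  omega

theorem IsFanned.exists_hits (hQ : IsFanned s P U Q) {ϱ : Set (OSep G)}
    (hϱ : ϱ.Pairwise fun r s => r ≤ s.inv)
    (hU : s.order * (starInterior ϱ).encard + (starInterior ϱ).encard < U.encard) :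
    ∃ t ∈ ϱ, Hits s P t := by
  by_contra! hno
  simp only [Hits, not_forall, not_exists, not_and] at hno
  have h : ∀ w ∈ U \ starInterior ϱ, ∃ p : V × V,
      p ∈ (s.left ∩ s.right) ×ˢ starInterior ϱ ∧ p.2 ∈ Q p.1 w ∧ p.2 ∉ (P p.1).support := by
    rintro w ⟨hw, hwi⟩
    simp only [starInterior, Set.mem_ofPred_eq, not_forall] at hwi
    obtain ⟨t, ht, hwt⟩ := hwi
    obtain ⟨x, hx, hPx⟩ := hno t ht
    obtain ⟨v, hv, hvt⟩ :=
      hQ.separator x hx w hw t ((t.mem_or_mem w).resolve_right hwt) hPx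
    refine ⟨(x, v), ⟨hx, fun y hy => ?_⟩, hv, fun h => hPx v h hvt.1⟩
    by_cases hyt : y = t
    · exact hyt ▸ hvt.2
    · exact (hϱ ht hy (Ne.symm hyt)).1 hvt.1
  choose! f hf using h
  have hinj : Set.InjOn f (U \ starInterior ϱ) := by
    intro w hw w' hw' hww
    by_contra hne
    refine (hf w hw).2.2 (hQ.disjoint _ (hf w hw).1.1 w hw.1 w' hw'.1 hne _ (hf w hw).2.1 ?_)
    rw [hww]
    exact (hf w' hw').2.1
  have h1 := Set.encard_le_encard_of_injOn (fun w hw => (hf w hw).1) hinj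
  rw [Set.encard_prod] at h1
  have h2 : U.encard ≤ (U \ starInterior ϱ).encard + (starInterior ϱ).encard := by
    refine le_trans (Set.encard_le_encard fun v hv => ?_) (Set.encard_union_le _ _)
    by_cases h : v ∈ starInterior ϱ
    · exact Or.inr h
    · exact Or.inl ⟨hv, h⟩
  exact absurd (hU.trans_le (h2.trans (add_le_add_left h1 _))) (lt_irrefl _)

theorem IsNice.exists_isGuide_of_isLeftRobust (hF : IsNice k F) (hm : IsBounded m F)
    (hs : s ∈ sepSys G k)
    (hr : IsLeftRobust (max (3 * k - 2) (k * (k - 1) * m + m)) s) :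
    ∃ H, IsGuide k F s H := by
  have hk := pos_of_mem_sepSys hs
  obtain ⟨U, hUs, hU, a, P, Q, hP, hQ⟩ := hr.exists_isFanned
  have hU2 : 2 * (k - 1) < U.encard := by
    rw [hU]
    have : 2 * (k - 1) < max (3 * k - 2) (k * (k - 1) * m + m) :=
      lt_of_lt_of_le (by omega) (le_max_left _ _)
    exact_mod_cast this
  refine ⟨Hits s P, fun y hy => hQ.hits_or_hits hU2 hy, ?_, fun y hy => hP.sup_mem hy,
    fun y hy => hP.small hy, ?_⟩
  · intro y _ z _ hyz h x hx
    obtain ⟨v, hv, hvy⟩ := h x hx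
    exact ⟨v, hv, hyz.1 hvy⟩
  · intro ϱ hϱ hcos _
    suffices h : s = OSep.cosmall G ∅ ∨ ∃ t ∈ ϱ, Hits s P t by
      refine h.imp_right ?_
      rintro ⟨t, ht, h⟩
      exact ⟨t, ht, h, hF.shiftStar_mem_of_hits hP hs hϱ hcos ht h⟩
    by_cases hk1 : k = 1
    · have hsep := left_inter_right_eq_empty hs hk1
      rcases ϱ.eq_empty_or_nonempty with rfl | ⟨t, ht⟩
      · left
        have h1 : (Set.univ : Set V).encard ≤ U.encard := by
          have h2 : starInterior (∅ : Set (OSep G)) = Set.univ := by simp [starInterior]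
          rw [← h2, hU]
          refine (hm ∅ hϱ).trans ?_
          exact_mod_cast le_trans (Nat.le_add_left _ _) (le_max_right _ _)
        have h2 : U = Set.univ := Set.Finite.eq_of_subset_of_encard_le
          (Set.finite_of_encard_eq_coe hU) (Set.subset_univ _) h1
        have h3 : s.left = Set.univ := Set.univ_subset_iff.1 (h2 ▸ hUs)
        rw [h3, Set.univ_inter] at hsep
        exact OSep.ext h3 hsep
      · exact Or.inr ⟨t, ht, fun x hx => absurd hx (by simp [hsep])⟩
    · right
      refine hQ.exists_hits (hF.1 ϱ hϱ).1.2.2 ?_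
      have hb := hm ϱ hϱ
      obtain ⟨i, hi⟩ := ENat.ne_top_iff_exists.1 (hb.trans_lt (ENat.natCast_lt_top m)).ne
      obtain ⟨n, hn⟩ := ENat.ne_top_iff_exists.1 (order_lt_top hs).ne
      rw [mem_sepSys, ← hn] at hs
      rw [← hi] at hb
      rw [hU, ← hi, ← hn]
      norm_cast at *
      have h1 : n * i + i ≤ (k - 1) * m + m :=
        add_le_add (Nat.mul_le_mul (by omega) hb) hb
      rcases Nat.eq_zero_or_pos m with rfl | hm0
      · exact lt_of_le_of_lt h1 (lt_of_lt_of_le (by omega) (le_max_left _ _))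
      · refine lt_of_le_of_lt h1 (lt_of_lt_of_le ?_ (le_max_right _ _))
        have h2 : 0 < (k - 1) * m := Nat.mul_pos (by omega) hm0
        have h3 : 2 * ((k - 1) * m) ≤ k * ((k - 1) * m) := Nat.mul_le_mul_right _ (by omega)
        rw [mul_assoc]
        omega

end

section

variable {V : Type u} {G : SimpleGraph V}

/-- A rooted tree on `W`, given by its parent map, whose non-root nodes `c` are labelled by the
separation `lab c` of the edge from `c` to its parent. The tree is over `F` except at the root,
whose star is `X`; the label of the root is `z`. -/
structure RootedTree (S : Set (OSep G)) (F : Set (Set (OSep G))) (X : Set (OSep G)) (z : OSep G)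
    (W : Type*) where
  root : W
  parent : W → W
  depth : W → ℕ
  lab : W → OSep G
  depth_lt : ∀ c ≠ root, depth (parent c) < depth c
  lab_root : lab root = z
  lab_mem : ∀ c ≠ root, lab c ∈ S
  star_root : {s | ∃ c, c ≠ root ∧ parent c = root ∧ lab c = s} = X
  star_mem : ∀ w ≠ root, insert (lab w).inv {s | ∃ c, c ≠ root ∧ parent c = w ∧ lab c = s} ∈ F
  lab_inj : ∀ c ≠ root, ∀ c' ≠ root, parent c = parent c' → lab c = lab c' → c = c'
  lab_ne : ∀ c ≠ root, parent c ≠ root → lab c ≠ (lab (parent c)).inv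

namespace RootedTree

variable {S : Set (OSep G)} {F : Set (Set (OSep G))} {X : Set (OSep G)} {z : OSep G}

section join

variable {Y : X → Set (OSep G)} {W : X → Type*} (R : ∀ x : X, RootedTree S F (Y x) x (W x))

open Classical in
/-- The parent map of a join of rooted trees. -/
noncomputable def joinParent : Option (Σ x : X, W x) → Option (Σ x : X, W x)
  | none => none
  | some p => if p.2 = (R p.1).root then none else some ⟨p.1, (R p.1).parent p.2⟩

/-- The labels of a join of rooted trees. -/
def joinLab (z : OSep G) : Option (Σ x : X, W x) → OSep G
  | none => z
  | some p => (R p.1).lab p.2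

theorem joinParent_root (x : X) : joinParent R (some ⟨x, (R x).root⟩) = none := by
  simp [joinParent]

theorem joinParent_of_ne {x : X} {w : W x} (h : w ≠ (R x).root) :
    joinParent R (some ⟨x, w⟩) = some ⟨x, (R x).parent w⟩ := by
  simp [joinParent, h]

theorem joinParent_eq_none {x : X} {w : W x} (h : joinParent R (some ⟨x, w⟩) = none) :
    w = (R x).root := by
  by_contra hw
  simp [joinParent_of_ne R hw] at h

theorem joinParent_eq_some {x : X} {w : W x} {c : Option (Σ x : X, W x)}
    (h : joinParent R c = some ⟨x, w⟩) :
    ∃ c' ≠ (R x).root, (R x).parent c' = w ∧ c = some ⟨x, c'⟩ := by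
  rcases c with _ | ⟨y, c⟩
  · simp [joinParent] at h
  · by_cases hc : c = (R y).root
    · subst hc
      simp [joinParent_root] at h
    · rw [joinParent_of_ne R hc] at h
      simp only [Option.some.injEq, Sigma.mk.injEq] at h
      obtain ⟨rfl, h⟩ := h
      exact ⟨c, hc, eq_of_heq h, rfl⟩

theorem joinLab_star (z : OSep G) (x : X) (w : W x) :
    {s | ∃ c, c ≠ none ∧ joinParent R c = some ⟨x, w⟩ ∧ joinLab R z c = s} =
      {s | ∃ c, c ≠ (R x).root ∧ (R x).parent c = w ∧ (R x).lab c = s} := by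
  ext s
  constructor
  · rintro ⟨c, -, h, rfl⟩
    obtain ⟨c', h1, h2, rfl⟩ := joinParent_eq_some R h
    exact ⟨c', h1, h2, rfl⟩
  · rintro ⟨c, h1, rfl, rfl⟩
    exact ⟨some ⟨x, c⟩, by simp, joinParent_of_ne R h1, rfl⟩

/-- Joining rooted trees at a new root. -/
noncomputable def join (hS : X ⊆ S) (hF : ∀ x : X, insert (x : OSep G).inv (Y x) ∈ F)
    (hY : ∀ x : X, (x : OSep G).inv ∉ Y x) (z : OSep G) :
    RootedTree S F X z (Option (Σ x : X, W x)) where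
  root := none
  parent := joinParent R
  depth w := w.elim 0 fun p => (R p.1).depth p.2 + 1
  lab := joinLab R z
  depth_lt := by
    rintro (_ | ⟨x, w⟩) h
    · exact absurd rfl h
    · by_cases hw : w = (R x).root
      · subst hw; simp [joinParent_root]
      · simpa [joinParent_of_ne R hw] using (R x).depth_lt w hw
  lab_root := rfl
  lab_mem := by
    rintro (_ | ⟨x, w⟩) h
    · exact absurd rfl h
    · by_cases hw : w = (R x).root
      · subst hw
        change (R x).lab (R x).root ∈ S
        rw [(R x).lab_root]
        exact hS x.2
      · exact (R x).lab_mem w hw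
  star_root := by
    ext s
    constructor
    · rintro ⟨_ | ⟨x, w⟩, h, hp, rfl⟩
      · exact absurd rfl h
      · rw [joinParent_eq_none R hp]
        change (R x).lab (R x).root ∈ X
        rw [(R x).lab_root]
        exact x.2
    · intro hs
      exact ⟨some ⟨⟨s, hs⟩, (R ⟨s, hs⟩).root⟩, by simp, joinParent_root R _,
        (R ⟨s, hs⟩).lab_root⟩
  star_mem := by
    rintro (_ | ⟨x, w⟩) h
    · exact absurd rfl h
    rw [joinLab_star]
    by_cases hw : w = (R x).root
    · subst hw
      rw [(R x).star_root]
      change insert ((R x).lab (R x).root).inv (Y x) ∈ F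
      rw [(R x).lab_root]
      exact hF x
    · exact (R x).star_mem w hw
  lab_inj := by
    rintro c hc c' hc' hp hl
    rcases h : joinParent R c with _ | ⟨x, w⟩
    · rw [h] at hp
      rcases c with _ | ⟨x, w⟩
      · exact absurd rfl hc
      rcases c' with _ | ⟨x', w'⟩
      · exact absurd rfl hc'
      rw [joinParent_eq_none R h, joinParent_eq_none R hp.symm] at hl ⊢
      have : x = x' := by
        apply Subtype.ext
        rw [← (R x).lab_root, ← (R x').lab_root]
        exact hl
      rw [this]
    · rw [h] at hp
      obtain ⟨d, h1, h2, rfl⟩ := joinParent_eq_some R h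
      obtain ⟨d', h1', h2', rfl⟩ := joinParent_eq_some R hp.symm
      rw [(R x).lab_inj d h1 d' h1' (h2.trans h2'.symm) hl]
  lab_ne := by
    intro c hc hp
    rcases h : joinParent R c with _ | ⟨x, w⟩
    · exact absurd h hp
    obtain ⟨d, h1, rfl, rfl⟩ := joinParent_eq_some R h
    by_cases hr : (R x).parent d = (R x).root
    · intro heq
      refine hY x ?_
      rw [← (R x).star_root]
      refine ⟨d, h1, hr, heq.trans ?_⟩
      change ((R x).lab ((R x).parent d)).inv = _
      rw [hr, (R x).lab_root]
    · exact (R x).lab_ne d h1 hr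

end join

/-- Transport along a bijection of the nodes. -/
def map {W W' : Type*} (R : RootedTree S F X z W) (e : W ≃ W') : RootedTree S F X z W' where
  root := e R.root
  parent w := e (R.parent (e.symm w))
  depth w := R.depth (e.symm w)
  lab w := R.lab (e.symm w)
  depth_lt := by
    intro c hc
    simpa using R.depth_lt (e.symm c) (by rintro h; exact hc (by simp [← h]))
  lab_root := by simpa using R.lab_root
  lab_mem := fun c hc => R.lab_mem (e.symm c) (by rintro h; exact hc (by simp [← h]))
  star_root := by
    refine Eq.trans ?_ R.star_root
    ext s
    constructor
    · rintro ⟨c, hc, hp, rfl⟩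
      exact ⟨e.symm c, by rintro h; exact hc (by simp [← h]), e.injective hp, rfl⟩
    · rintro ⟨c, hc, hp, rfl⟩
      exact ⟨e c, by simpa using hc, by simp [hp], by simp⟩
  star_mem := by
    intro w hw
    convert R.star_mem (e.symm w) (by rintro h; exact hw (by simp [← h])) using 2
    ext s
    constructor
    · rintro ⟨c, hc, hp, rfl⟩
      exact ⟨e.symm c, by rintro h; exact hc (by simp [← h]), by simp [← hp], rfl⟩
    · rintro ⟨c, hc, hp, rfl⟩
      exact ⟨e c, by simpa using hc, by simp [hp], by simp⟩
  lab_inj := by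
    intro c hc c' hc' hp hl
    exact e.symm.injective (R.lab_inj _ (by rintro h; exact hc (by simp [← h])) _
      (by rintro h; exact hc' (by simp [← h])) (e.injective hp) hl)
  lab_ne := by
    intro c hc hp
    simpa using R.lab_ne (e.symm c) (by rintro h; exact hc (by simp [← h]))
      (fun h => hp (by simp [h]))

end RootedTree

variable {S : Set (OSep G)} {F : Set (Set (OSep G))}

theorem exists_join (hSfin : S.Finite) {X : Set (OSep G)} (hX : X ⊆ S)
    (h : ∀ x ∈ X, ∃ Y, insert x.inv Y ∈ F ∧ x.inv ∉ Y ∧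
      ∃ W : Type u, Finite W ∧ Nonempty (RootedTree S F Y x W)) (z : OSep G) :
    ∃ W : Type u, Finite W ∧ Nonempty (RootedTree S F X z W) := by
  choose Y hY hYn W hW R using h
  have := (hSfin.subset hX).to_subtype
  have : ∀ x : X, Finite (W x x.2) := fun x => hW x x.2
  exact ⟨Option (Σ x : X, W x x.2), inferInstance,
    ⟨RootedTree.join (fun x : X => (R x x.2).some) hX (fun x => hY x x.2) (fun x => hYn x x.2) z⟩⟩

theorem Forced.exists_rootedTree (hSfin : S.Finite) {z : OSep G} (hz : Forced S F ∅ z) :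
    ∃ Y, insert z.inv Y ∈ F ∧ z.inv ∉ Y ∧
      ∃ W : Type u, Finite W ∧ Nonempty (RootedTree S F Y z W) := by
  induction hz with
  | hyp h => exact absurd h (Set.notMem_empty _)
  | @node ϱ t hϱ hϱS ht _ ih =>
    refine ⟨ϱ \ {t}, ?_, by simp, exists_join hSfin (Set.sdiff_subset.trans hϱS)
      (fun x hx => ih x hx.1 hx.2) _⟩
    rwa [OSep.inv_inv, Set.insert_sdiff_singleton, Set.insert_eq_of_mem ht]

theorem Refuted.exists_rootedTree (hSfin : S.Finite) (h : Refuted S F ∅) :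
    ∃ (n : ℕ) (X : Set (OSep G)), X ∈ F ∧ ∃ z, Nonempty (RootedTree S F X z (Fin n)) := by
  suffices h : ∃ X ∈ F, ∃ z, ∃ W : Type u, Finite W ∧ Nonempty (RootedTree S F X z W) by
    obtain ⟨X, hX, z, W, hW, ⟨R⟩⟩ := h
    obtain ⟨n, ⟨e⟩⟩ := Finite.exists_equiv_fin W
    exact ⟨n, X, hX, z, ⟨R.map e⟩⟩
  rcases h with h | ⟨z, hz, hz'⟩
  · have : Inhabited (OSep G) := ⟨OSep.cosmall G ∅⟩
    exact ⟨∅, h, default, exists_join hSfin (Set.empty_subset _) (fun x hx => absurd hx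
      (Set.notMem_empty x)) _⟩
  · cases hz with
    | hyp h => exact absurd h (Set.notMem_empty _)
    | @node ϱ t hϱ hϱS ht hx =>
      refine ⟨ϱ, hϱ, t, exists_join hSfin hϱS (fun x hxϱ => ?_) _⟩
      by_cases hxt : x = t
      · subst hxt
        exact Forced.exists_rootedTree hSfin hz'
      · exact (hx x hxϱ hxt).exists_rootedTree hSfin

end

section

variable {V : Type u} {G : SimpleGraph V} {S : Set (OSep G)} {F : Set (Set (OSep G))}

namespace RootedTree

variable {X : Set (OSep G)} {z : OSep G} {W : Type*} (R : RootedTree S F X z W)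

/-- The graph of a rooted tree. -/
def graph : SimpleGraph W where
  Adj u v := (u ≠ R.root ∧ R.parent u = v) ∨ (v ≠ R.root ∧ R.parent v = u)
  symm := ⟨fun _ _ h => h.symm⟩
  loopless := ⟨by
    rintro u (⟨h, hp⟩ | ⟨h, hp⟩) <;> exact (R.depth_lt u h).ne (by rw [hp])⟩

theorem graph_adj_parent {u : W} (h : u ≠ R.root) : R.graph.Adj u (R.parent u) :=
  Or.inl ⟨h, rfl⟩

theorem parent_ne {u : W} (h : u ≠ R.root) (hp : R.parent u ≠ R.root) :
    R.parent (R.parent u) ≠ u := by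
  intro h'
  have h1 := R.depth_lt u h
  have h2 := R.depth_lt _ hp
  rw [h'] at h2
  exact h1.asymm h2

theorem graph_connected : R.graph.Connected := by
  have h : ∀ n, ∀ u, R.depth u = n → R.graph.Reachable u R.root := by
    intro n
    induction n using Nat.strong_induction_on with
    | _ n ih =>
      rintro u rfl
      by_cases hu : u = R.root
      · rw [hu]
      · exact (R.graph_adj_parent hu).reachable.trans (ih _ (R.depth_lt u hu) _ rfl)
  have : Nonempty W := ⟨R.root⟩
  exact ⟨fun u v => (h _ u rfl).trans (h _ v rfl).symm⟩

theorem graph_isTree [Finite W] : R.graph.IsTree := by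
  classical
  rw [SimpleGraph.isTree_iff_connected_and_card]
  refine ⟨R.graph_connected, ?_⟩
  let f : {u // u ≠ R.root} → R.graph.edgeSet :=
    fun u => ⟨s(u.1, R.parent u.1), R.graph_adj_parent u.2⟩
  have hf : Function.Bijective f := by
    constructor
    · rintro ⟨u, hu⟩ ⟨v, hv⟩ huv
      have h := congrArg Subtype.val huv
      simp only [f, Sym2.eq_iff] at h
      rcases h with h | ⟨h1, h2⟩
      · exact Subtype.ext h.1
      · exact absurd (by rw [h2, ← h1]) (R.parent_ne hu (by rw [h2]; exact hv))
    · rintro ⟨e, he⟩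
      induction e with
      | _ u v =>
        have he' : R.graph.Adj u v := he
        rcases he' with ⟨h, hp⟩ | ⟨h, hp⟩
        · exact ⟨⟨u, h⟩, Subtype.ext (by simp [f, hp])⟩
        · exact ⟨⟨v, h⟩, Subtype.ext (by simp [f, hp, Sym2.eq_swap])⟩
  rw [← Nat.card_congr (Equiv.ofBijective f hf)]
  have h1 : Nat.card {u // u = R.root} + Nat.card {u // u ≠ R.root} = Nat.card W := by
    rw [← Nat.card_sum]
    exact Nat.card_congr (Equiv.sumCompl (fun u => u = R.root))
  have h2 : Nat.card {u // u = R.root} = 1 := by simp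
  omega

open Classical in
/-- The edge labels of a rooted tree. -/
noncomputable def dartLab (d : R.graph.Dart) : OSep G :=
  if d.fst ≠ R.root ∧ R.parent d.fst = d.snd then R.lab d.fst else (R.lab d.snd).inv

theorem dartLab_up {d : R.graph.Dart} (h : d.fst ≠ R.root) (hp : R.parent d.fst = d.snd) :
    R.dartLab d = R.lab d.fst := if_pos ⟨h, hp⟩

theorem dartLab_down {d : R.graph.Dart} (h : d.snd ≠ R.root) (hp : R.parent d.snd = d.fst) :
    R.dartLab d = (R.lab d.snd).inv := by
  refine if_neg ?_
  rintro ⟨h1, h2⟩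
  exact R.parent_ne h1 (h2 ▸ h) (by rw [h2, hp])

theorem dartLab_symm (d : R.graph.Dart) : R.dartLab d.symm = (R.dartLab d).inv := by
  rcases d.adj with ⟨h, hp⟩ | ⟨h, hp⟩
  · rw [R.dartLab_up h hp, R.dartLab_down (d := d.symm) h hp]; rfl
  · rw [R.dartLab_down h hp, R.dartLab_up (d := d.symm) h hp]; rfl

theorem isSTree [Finite W] (hS : InvClosed S) : IsSTree S R.graph R.dartLab := by
  refine ⟨R.graph_isTree, fun d => ?_, R.dartLab_symm⟩
  rcases d.adj with ⟨h, hp⟩ | ⟨h, hp⟩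
  · rw [R.dartLab_up h hp]; exact R.lab_mem _ h
  · rw [R.dartLab_down h hp]; exact hS _ (R.lab_mem _ h)

theorem isOver (hX : X ∈ F) : IsOver F R.graph R.dartLab := by
  intro w
  by_cases hw : w = R.root
  · convert hX
    refine Eq.trans ?_ R.star_root
    ext s
    constructor
    · rintro ⟨d, rfl, rfl⟩
      rcases d.adj with ⟨h, hp⟩ | ⟨h, hp⟩
      · exact ⟨d.fst, h, hp.trans hw, (R.dartLab_up h hp).symm⟩
      · exact absurd hw h
    · rintro ⟨c, hc, hp, rfl⟩
      exact ⟨⟨(c, R.parent c), R.graph_adj_parent hc⟩, hp.trans hw.symm, R.dartLab_up hc rfl⟩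
  · convert R.star_mem w hw
    ext s
    constructor
    · rintro ⟨d, rfl, rfl⟩
      rcases d.adj with ⟨h, hp⟩ | ⟨h, hp⟩
      · exact Or.inr ⟨d.fst, h, hp, (R.dartLab_up h hp).symm⟩
      · exact Or.inl (R.dartLab_down h hp)
    · rintro (rfl | ⟨c, hc, rfl, rfl⟩)
      · exact ⟨⟨(R.parent w, w), (R.graph_adj_parent hw).symm⟩, rfl, R.dartLab_down hw rfl⟩
      · exact ⟨⟨(c, R.parent c), R.graph_adj_parent hc⟩, rfl, R.dartLab_up hc rfl⟩

theorem dartLab_injective {d d' : R.graph.Dart} (hs : d.snd = d'.snd)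
    (hl : R.dartLab d = R.dartLab d') : d = d' := by
  refine SimpleGraph.Dart.ext _ _ (Prod.ext ?_ hs)
  rcases d.adj with ⟨h, hp⟩ | ⟨h, hp⟩ <;> rcases d'.adj with ⟨h', hp'⟩ | ⟨h', hp'⟩
  · rw [R.dartLab_up h hp, R.dartLab_up h' hp'] at hl
    exact R.lab_inj _ h _ h' (hp.trans (hs.trans hp'.symm)) hl
  · rw [R.dartLab_up h hp, R.dartLab_down h' hp', ← hs, ← hp] at hl
    exact absurd hl (R.lab_ne _ h (by rw [hp, hs]; exact h'))
  · rw [R.dartLab_down h hp, R.dartLab_up h' hp', hs, ← hp'] at hl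
    exact absurd hl.symm (R.lab_ne _ h' (by rw [hp', ← hs]; exact h))
  · rw [← hp, ← hp', hs]

end RootedTree

/-- An orientation of the edges of a finite tree has a sink. -/
theorem exists_sink {W : Type*} [Finite W] {T : SimpleGraph W} (hT : T.IsTree) (p : T.Dart → Prop)
    (hp : ∀ d, p d ∨ p d.symm) : ∃ t, ∀ d : T.Dart, d.snd = t → p d := by
  by_contra! h
  choose f hf hfp using h
  let g : W → T.edgeSet := fun t => ⟨(f t).edge, (f t).edge_mem⟩
  have hg : Function.Injective g := by
    intro t t' htt
    have h1 : (f t).edge = (f t').edge := congrArg Subtype.val htt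
    rcases (SimpleGraph.dart_edge_eq_iff _ _).1 h1 with h2 | h2
    · rw [← hf t, h2, hf t']
    · exact absurd (hp (f t')) (not_or.2 ⟨hfp t', h2 ▸ hfp t⟩)
  have h1 := (SimpleGraph.isTree_iff_connected_and_card.1 hT).2
  have h2 := Nat.card_le_card_of_injective g hg
  omega

/-- A node whose star is `{s.inv}` is a leaf. -/
theorem isLeafSeparation_of_nodeStar {W : Type*} {T : SimpleGraph W} {α : T.Dart → OSep G}
    (hsymm : ∀ d, α d.symm = (α d).inv)
    (hinj : ∀ d d' : T.Dart, d.snd = d'.snd → α d = α d' → d = d') {x : W} {s : OSep G}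
    (hx : nodeStar T α x = {s.inv}) : IsLeafSeparation T α s := by
  obtain ⟨d, rfl, hd⟩ : s.inv ∈ nodeStar T α x := by rw [hx]; rfl
  refine ⟨d.symm, ?_, by rw [hsymm, hd]; rfl⟩
  ext y
  constructor
  · intro hy
    let d' : T.Dart := ⟨(y, d.snd), hy.symm⟩
    have h1 : α d' ∈ nodeStar T α d.snd := ⟨d', rfl, rfl⟩
    rw [hx] at h1
    exact congrArg (fun d : T.Dart => d.fst) (hinj d' d rfl (h1.trans hd.symm))
  · rintro rfl
    exact d.adj.symm

end

section

variable {V : Type u} {G : SimpleGraph V} {k m : ℕ} {F : Set (Set (OSep G))} {σ : Set (OSep G)}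

/-- If `s.inv` lies in a profile avoiding `F`, then a tree over `F` and the singletons `{q.inv}` for
`q ∈ σ` has a node with star `{s.inv}`. -/
theorem IsNice.exists_nodeStar_of_profile (hF : IsNice k F) (hσ : IsStar σ)
    (hσk : σ ⊆ sepSys G k) {s : OSep G} (hs : s ∈ σ) {P : Set (OSep G)} (hP : IsProfile k P)
    (hA : Avoids P F) (hsP : s.inv ∈ P) {W : Type*} [Finite W] {T : SimpleGraph W}
    {α : T.Dart → OSep G} (hT : IsSTree (sepSys G k) T α) (ho : IsOver (addInverses F σ) T α) :
    ∃ x, nodeStar T α x = {s.inv} := by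
  have hd := isDownOrientation_of_isConsistent hF hP.1 hP.2.1 hA
  obtain ⟨t, ht⟩ := exists_sink hT.1 (fun d => α d ∈ P) fun d => by
    rw [hT.2.2]; exact hd.total _ (hT.2.1 d)
  have hsub : nodeStar T α t ⊆ P := by
    rintro _ ⟨d, hd, rfl⟩
    exact ht d hd
  rcases ho t with h | ⟨q, hq, h⟩
  · exact absurd hsub (hA _ h)
  · by_cases hqs : q = s
    · exact ⟨t, hqs ▸ h⟩
    · have h1 : q.inv ∈ P := hsub (by rw [h]; rfl)
      exact absurd h1 (hd.not_both q (hd.lower q (hσk hq) _ hsP (hσ.2.2 hq hs hqs)))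

/-- If the left side of `s` is large, then a tree over the bounded family `F` and the singletons
`{q.inv}` for `q ∈ σ` has a node with star `{s.inv}`. -/
theorem IsBounded.exists_nodeStar (hF : IsBounded m F) (hσ : IsStar σ)
    (hσk : σ ⊆ sepSys G k) {s : OSep G} (hs : s ∈ σ) (hk : (k : ℕ∞) ≤ s.left.encard)
    (hm : k ≠ 1 → (m : ℕ∞) < s.left.encard) {W : Type*} [Finite W] {T : SimpleGraph W}
    {α : T.Dart → OSep G} (hT : IsSTree (sepAbove k σ) T α)
    (ho : IsOver (addInverses (traceFamily k F σ) σ) T α) :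
    ∃ x, nodeStar T α x = {s.inv} := by
  obtain ⟨t, ht⟩ := exists_sink hT.1 (fun d => s ≤ (α d).inv) fun d => by
    rw [hT.2.2]; exact ((hT.2.1 d).2 s hs).symm
  have hsub : ∀ x ∈ nodeStar T α t, s ≤ x.inv := by
    rintro _ ⟨d, hd, rfl⟩
    exact ht d hd
  rcases ho t with h | ⟨q, hq, h⟩
  · exfalso
    have hint : s.left ⊆ starInterior (nodeStar T α t) := fun v hv x hx => (hsub x hx).1 hv
    by_cases hk1 : k = 1
    · have h1 : s.left ⊆ s.left ∩ s.right := fun v hv => ⟨hv, h.2 hk1 (hint hv) s hs⟩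
      exact absurd (hk.trans (Set.encard_le_encard h1)) (not_le.2 (hσk hs))
    · exact absurd ((Set.encard_le_encard hint).trans (hF _ h.1)) (not_le.2 (hm hk1))
  · by_cases hqs : q = s
    · exact ⟨t, hqs ▸ h⟩
    · have h1 : s ≤ q := hsub q.inv (by rw [h]; rfl)
      have h2 : s ≤ q.inv := hσ.2.2 hs hq (Ne.symm hqs)
      have h3 : s.left ⊆ q.left ∩ q.right := fun v hv => ⟨h1.1 hv, h2.1 hv⟩
      exact absurd (hk.trans (Set.encard_le_encard h3)) (not_le.2 (hσk hq))

theorem IsLeftRobust.le_encard_left {ℓ : ℕ} {s : OSep G} (hs : IsLeftRobust ℓ s) :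
    (ℓ : ℕ∞) ≤ s.left.encard := by
  obtain ⟨-, U, hU, hUℓ, -⟩ := hs
  exact hUℓ ▸ Set.encard_le_encard hU

theorem IsSTree.mono {S S' : Set (OSep G)} (h : S ⊆ S') {W : Type*} {T : SimpleGraph W}
    {α : T.Dart → OSep G} (hT : IsSTree S T α) : IsSTree S' T α :=
  ⟨hT.1, fun d => h (hT.2.1 d), hT.2.2⟩

theorem addInverses_mono {F F' : Set (Set (OSep G))} (h : F ⊆ F') (σ : Set (OSep G)) :
    addInverses F σ ⊆ addInverses F' σ := Set.union_subset_union_left _ h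

end

end TangleTree

theorem lemma4p4 {V : Type*} (G : SimpleGraph V) (k m : ℕ) (F : Set (Set (OSep G)))
    (hF_nice : IsNice k F) (hF_bdd : IsBounded m F)
    (σ : Set (OSep G)) (hσ : IsStar σ) (hσk : σ ⊆ sepSys G k) (hσ_fin : σ.Finite)
    (hσ_int : (starInterior σ).Finite)
    (hσ_sep : ∀ s ∈ σ, IsLeftRobust (max (3 * k - 2) (k * (k - 1) * m + m)) s ∨
      ∃ P : Set (OSep G), IsProfile k P ∧ Avoids P F ∧ IsCloselyRelated k s.inv P) :
    (∃ O : Set (OSep G), IsTangle (sepSys G k) (addInverses F σ) O) ∨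
    (∃ (n : ℕ) (T : SimpleGraph (Fin n)) (α : T.Dart → OSep G),
      IsSTree (sepSys G k) T α ∧ IsOver (addInverses F σ) T α ∧
      ∀ s ∈ σ, IsLeafSeparation T α s) := by
  have hguide : ∀ s ∈ σ, ∃ H, IsGuide k F s H := by
    intro s hs
    rcases hσ_sep s hs with h | ⟨P, hP, hA, h⟩
    · exact hF_nice.exists_isGuide_of_isLeftRobust hF_bdd (hσk hs) h
    · exact ⟨_, hF_nice.isGuide_of_profile hP hA h⟩
  have hdual := isDual_sepAbove hF_nice hσ hσ_fin fun s hs => (hguide s hs).choose_spec.uncrosses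
  have hfin : (sepAbove k σ).Finite := (finite_nestedAbove hσ_fin hσ_int).subset
    Set.inter_subset_right
  by_cases href : Refuted (sepAbove k σ) (addInverses (traceFamily k F σ) σ) ∅
  · right
    obtain ⟨n, X, hX, z, ⟨R⟩⟩ := href.exists_rootedTree hfin
    have hT := R.isSTree hdual.inv_closed
    have ho := R.isOver hX
    have hT' := hT.mono Set.inter_subset_left
    have ho' : IsOver (addInverses F σ) R.graph R.dartLab :=
      fun t => addInverses_mono (Set.sep_subset _ _) σ (ho t)
    refine ⟨n, R.graph, R.dartLab, hT', ho', fun s hs => ?_⟩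
    suffices h : ∃ x, nodeStar R.graph R.dartLab x = {s.inv} by
      obtain ⟨x, hx⟩ := h
      exact isLeafSeparation_of_nodeStar R.dartLab_symm (fun _ _ => R.dartLab_injective) hx
    rcases hσ_sep s hs with h | ⟨P, hP, hA, h⟩
    · have hk := pos_of_mem_sepSys (hσk hs)
      refine hF_bdd.exists_nodeStar hσ hσk hs (le_trans ?_ h.le_encard_left)
        (fun hk1 => lt_of_lt_of_le ?_ h.le_encard_left) hT ho
      · exact_mod_cast le_trans (by omega) (le_max_left _ _)
      · norm_cast
        rcases Nat.eq_zero_or_pos m with rfl | hm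
        · exact lt_of_lt_of_le (by omega) (le_max_left _ _)
        · refine lt_of_lt_of_le ?_ (le_max_right _ _)
          have : 0 < k * (k - 1) * m := Nat.mul_pos (Nat.mul_pos hk (by omega)) hm
          omega
    · exact hF_nice.exists_nodeStar_of_profile hσ hσk hs hP hA h.1 hT' ho'
  · left
    obtain ⟨O, hO, hA⟩ := hdual.exists_orientation hfin href
    exact exists_extension hF_nice hσ hσk hσ_fin hguide hO hA
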